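/- Consider the situation calculus with sorts object, action and situation, an initial situation $S_0$, a successor function $do(a,s)$, a precedence relation $\sqsubset$ on situations and a predicate $\mathrm{Poss}(a,s)$. There are a countably infinite set of object constants, finitely many relational fluents $F(\vec x,s)$ and finitely many action types $A(\vec x)$, all arguments $\vec x$ being of sort object, and there are no other function symbols and no non-fluent predicates. A \emph{basic action theory} $\mathcal D$ consists of: a finite set $\mathcal D_0$ of first-order sentences uniform in $S_0$ (the initial situation description); one precondition axiom $\mathrm{Poss}(A(\vec x),s)\equiv\phi_A(\vec x,s)$ per action type and one successor state axiom $F(\vec x,do(a,s))\equiv\phi_F(\vec x,a,s)$ per fluent, where $\phi_A,\phi_F$ are first-order formulas uniform in $s$ with no free variables other than those displayed; unique name axioms for actions and domain closure on action types; unique name axioms for the object constants; and the foundational axioms of the situation calculus, including the second-order induction axiom on situations. For $b\in\mathbb N$, a situation $s$ is \emph{bounded by $b$}, $\mathrm{Bounded}_b(s)$, if for every fluent $F$ there are fewer than $b$ distinct tuples $\vec x$ with $F(\vec x,s)$. A situation $s$ is \emph{executable} if $\mathrm{Poss}(a,s')$ holds whenever $do(a,s')\sqsubset s$ or $do(a,s')=s$.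 The theory $\mathcal D$ is \emph{bounded by $b$} if $\mathcal D\models\forall s.\,(\mathrm{Executable}(s)\supset\mathrm{Bounded}_b(s))$, and its initial situation is \emph{bounded by $b$} if $\mathcal D\models\mathrm{Bounded}_b(S_0)$ (in particular, if $\mathcal D_0\models\mathrm{Bounded}_b(S_0)$). \textbf{Theorem.} Given a basic action theory whose initial situation is bounded by $b$, it is decidable whether the entire theory is bounded by $b$. That is, there is a single algorithm (a total computable function) which, on input of a code of a finite basic action theory $\mathcal D$ together with a number $b$ such that the initial situation of $\mathcal D$ is bounded by $b$, answers ``true'' if and only if $\mathcal D$ is bounded by $b$. -/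

import Mathlib

/-! Situation calculus basic action theories over relational fluents. Objects are named by the
countably many constants `c₀, c₁, …` (indexed by `ℕ`); there are finitely many fluents and finitely
many action types, whose (non-situation) arguments are objects. -/

universe u

namespace SitCalc

/-- A signature: the list of arities of the fluents (situation argument not counted) and the list
of arities of the action types. -/
structure Signature where
  fluentArities : List ℕ
  actionArities : List ℕ

namespace Signature

/-- The fluent symbols. -/
abbrev Fluent (S : Signature) : Type := Fin S.fluentArities.length

/-- The action types. -/
abbrev ActionType (S : Signature) : Type := Fin S.actionArities.length

/-- Number of object arguments of a fluent. -/
abbrev fluentArity (S : Signature) (F : S.Fluent) : ℕ := S.fluentArities.get F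

/-- Number of arguments of an action type. -/
abbrev actionArity (S : Signature) (A : S.ActionType) : ℕ := S.actionArities.get A

end Signature

/-- Object terms with `n` object variables in scope. -/
inductive ObjTerm (n : ℕ) : Type
  | var (i : Fin n) : ObjTerm n
  | const (c : ℕ) : ObjTerm n

/-- Action terms with `n` object variables and `m` action variables in scope. -/
inductive ActTerm (S : Signature) (n m : ℕ) : Type
  | var (j : Fin m) : ActTerm S n m
  | app (A : S.ActionType) (ts : Fin (S.actionArity A) → ObjTerm n) : ActTerm S n m

/-- First-order formulas of the situation calculus that are uniform in one situation term, with
free variables among `n` object variables and `m` action variables. The unique situation term is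
suppressed, `Poss` does not occur, and quantifiers range over objects and over actions. Variables
are de Bruijn indices: a quantifier binds index `0` of its sort. -/
inductive Formula (S : Signature) : ℕ → ℕ → Type
  | objEq {n m : ℕ} (t t' : ObjTerm n) : Formula S n m
  | actEq {n m : ℕ} (α α' : ActTerm S n m) : Formula S n m
  | fluent {n m : ℕ} (F : S.Fluent) (ts : Fin (S.fluentArity F) → ObjTerm n) : Formula S n m
  | not {n m : ℕ} (φ : Formula S n m) : Formula S n m
  | and {n m : ℕ} (φ ψ : Formula S n m) : Formula S n m
  | exObj {n m : ℕ} (φ : Formula S (n + 1) m) : Formula S n m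
  | exAct {n m : ℕ} (φ : Formula S n (m + 1)) : Formula S n m

/-- The data of a basic action theory over the signature `S`. -/
structure BAT (S : Signature) where
  /-- The initial situation description: finitely many sentences, read in the initial situation. -/
  initial : List (Formula S 0 0)
  /-- The right-hand side `φ_A(x, s)` of the precondition axiom of each action type. -/
  precond : ∀ A : S.ActionType, Formula S (S.actionArity A) 0
  /-- The right-hand side `φ_F(x, a, s)` of the successor state axiom of each fluent. -/
  succState : ∀ F : S.Fluent, Formula S (S.fluentArity F) 1

/-- Interpretations of the full language (sorts object, action, situation). No axiom is assumed. -/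
structure Interp (S : Signature) : Type (u + 1) where
  Obj : Type u
  Act : Type u
  Sit : Type u
  const : ℕ → Obj
  action : ∀ A : S.ActionType, (Fin (S.actionArity A) → Obj) → Act
  s0 : Sit
  doAct : Act → Sit → Sit
  /-- The strict precedence relation between situations. -/
  Before : Sit → Sit → Prop
  Poss : Act → Sit → Prop
  fluent : ∀ F : S.Fluent, (Fin (S.fluentArity F) → Obj) → Sit → Prop

/-- Value of an object term. -/
def ObjTerm.eval {S : Signature} (M : Interp.{u} S) {n : ℕ} (v : Fin n → M.Obj) :
    ObjTerm n → M.Obj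
  | .var i => v i
  | .const c => M.const c

/-- Value of an action term. -/
def ActTerm.eval {S : Signature} (M : Interp.{u} S) {n m : ℕ} (v : Fin n → M.Obj)
    (w : Fin m → M.Act) : ActTerm S n m → M.Act
  | .var j => w j
  | .app A ts => M.action A (fun i => (ts i).eval M v)

/-- Truth of a uniform formula in the situation `s` under assignments `v` and `w`. -/
def Formula.Holds {S : Signature} (M : Interp.{u} S) (s : M.Sit) :
    {n m : ℕ} → Formula S n m → (Fin n → M.Obj) → (Fin m → M.Act) → Prop
  | _, _, .objEq t t', v, _ => t.eval M v = t'.eval M v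
  | _, _, .actEq α α', v, w => α.eval M v w = α'.eval M v w
  | _, _, .fluent F ts, v, _ => M.fluent F (fun i => (ts i).eval M v) s
  | _, _, .not φ, v, w => ¬ φ.Holds M s v w
  | _, _, .and φ ψ, v, w => φ.Holds M s v w ∧ ψ.Holds M s v w
  | _, _, .exObj φ, v, w => ∃ x : M.Obj, φ.Holds M s (Fin.cons x v) w
  | _, _, .exAct φ, v, w => ∃ a : M.Act, φ.Holds M s v (Fin.cons a w)

namespace Interp

variable {S : Signature}

/-- The foundational axioms of the situation calculus (with the second-order induction axiom). -/
structure Foundational (M : Interp.{u} S) : Prop where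
  do_inj : ∀ (a a' : M.Act) (s s' : M.Sit), M.doAct a s = M.doAct a' s' → a = a' ∧ s = s'
  induction : ∀ P : M.Sit → Prop,
    P M.s0 → (∀ (a : M.Act) (s : M.Sit), P s → P (M.doAct a s)) → ∀ s, P s
  not_before_s0 : ∀ s : M.Sit, ¬ M.Before s M.s0
  before_do : ∀ (a : M.Act) (s s' : M.Sit),
    M.Before s (M.doAct a s') ↔ (M.Before s s' ∨ s = s')

/-- Unique names for actions and domain closure on action types. -/
structure ActionAxioms (M : Interp.{u} S) : Prop where
  names_ne : ∀ (A A' : S.ActionType) (x : Fin (S.actionArity A) → M.Obj)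
    (y : Fin (S.actionArity A') → M.Obj), A ≠ A' → M.action A x ≠ M.action A' y
  args_inj : ∀ (A : S.ActionType) (x y : Fin (S.actionArity A) → M.Obj),
    M.action A x = M.action A y → x = y
  closure : ∀ a : M.Act, ∃ (A : S.ActionType) (x : Fin (S.actionArity A) → M.Obj),
    a = M.action A x

/-- Unique names for the object constants. -/
def UniqueNames (M : Interp.{u} S) : Prop := Function.Injective M.const

/-- `M` satisfies all axioms of the basic action theory `D`. -/
structure IsModel (M : Interp.{u} S) (D : BAT S) : Prop where
  initial : ∀ φ ∈ D.initial, φ.Holds M M.s0 Fin.elim0 Fin.elim0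
  precond : ∀ (A : S.ActionType) (x : Fin (S.actionArity A) → M.Obj) (s : M.Sit),
    M.Poss (M.action A x) s ↔ (D.precond A).Holds M s x Fin.elim0
  succState : ∀ (F : S.Fluent) (x : Fin (S.fluentArity F) → M.Obj) (a : M.Act) (s : M.Sit),
    M.fluent F x (M.doAct a s) ↔ (D.succState F).Holds M s x (fun _ => a)
  actionAxioms : M.ActionAxioms
  uniqueNames : M.UniqueNames
  foundational : M.Foundational

/-- Every action performed in reaching `s` was possible in the situation in which it occurred. -/
def Executable (M : Interp.{u} S) (s : M.Sit) : Prop :=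
  ∀ (a : M.Act) (s' : M.Sit), (M.Before (M.doAct a s') s ∨ M.doAct a s' = s) → M.Poss a s'

/-- The fluent `F` has fewer than `b` distinct tuples in its extension in `s`. -/
def FluentBounded (M : Interp.{u} S) (F : S.Fluent) (b : ℕ) (s : M.Sit) : Prop :=
  ¬ ∃ x : Fin b → (Fin (S.fluentArity F) → M.Obj),
    (∀ i, M.fluent F (x i) s) ∧ (∀ i j, i ≠ j → x i ≠ x j)

/-- The situation `s` is bounded by `b`: every fluent is. -/
def Bounded (M : Interp.{u} S) (b : ℕ) (s : M.Sit) : Prop :=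
  ∀ F : S.Fluent, M.FluentBounded F b s

end Interp

namespace BAT

variable {S : Signature}

/-- The initial situation is bounded by `b` in every model of the theory. (This holds in particular
if the initial situation description alone entails it.) -/
def InitiallyBounded (D : BAT S) (b : ℕ) : Prop :=
  ∀ M : Interp.{u} S, M.IsModel D → M.Bounded b M.s0

/-- The theory entails that every executable situation is bounded by `b`. -/
def IsBounded (D : BAT S) (b : ℕ) : Prop :=
  ∀ M : Interp.{u} S, M.IsModel D → ∀ s : M.Sit, M.Executable s → M.Bounded b s

end BAT

/-! Gödel numbering of the finite syntactic objects, by Cantor pairing and the standard coding of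
lists of natural numbers. -/

/-- Code of an object term. -/
def ObjTerm.code {n : ℕ} : ObjTerm n → ℕ
  | .var i => Nat.pair 0 i
  | .const c => Nat.pair 1 c

/-- Code of a tuple of object terms. -/
def tupleCode {n k : ℕ} (ts : Fin k → ObjTerm n) : ℕ :=
  Encodable.encode (List.ofFn fun i => (ts i).code)

/-- Code of an action term. -/
def ActTerm.code {S : Signature} {n m : ℕ} : ActTerm S n m → ℕ
  | .var j => Nat.pair 0 j
  | .app A ts => Nat.pair 1 (Nat.pair A (tupleCode ts))

/-- Code of a formula. -/
def Formula.code {S : Signature} : {n m : ℕ} → Formula S n m → ℕ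
  | _, _, .objEq t t' => Nat.pair 0 (Nat.pair t.code t'.code)
  | _, _, .actEq α α' => Nat.pair 1 (Nat.pair α.code α'.code)
  | _, _, .fluent F ts => Nat.pair 2 (Nat.pair F (tupleCode ts))
  | _, _, .not φ => Nat.pair 3 φ.code
  | _, _, .and φ ψ => Nat.pair 4 (Nat.pair φ.code ψ.code)
  | _, _, .exObj φ => Nat.pair 5 φ.code
  | _, _, .exAct φ => Nat.pair 6 φ.code

/-- Code of a signature. -/
def Signature.code (S : Signature) : ℕ :=
  Nat.pair (Encodable.encode S.fluentArities) (Encodable.encode S.actionArities)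

/-- Code of a basic action theory, including its signature. -/
def BAT.code {S : Signature} (D : BAT S) : ℕ :=
  Nat.pair S.code
    (Nat.pair (Encodable.encode (D.initial.map Formula.code))
      (Nat.pair (Encodable.encode (List.ofFn fun A => (D.precond A).code))
        (Encodable.encode (List.ofFn fun F => (D.succState F).code))))

end SitCalc

-- Unique names make the object sort infinite. A finite partial bijection between two situations
-- that preserves the first `C` constants and the fluents, and covers both active domains, can
-- therefore be extended to any further object. A back-and-forth argument then shows that such a
-- matching preserves every formula with code below `C`, since such a formula mentions only
-- constants below `C` (`Match.holds_iff`).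
--
-- The key point is how matchings behave under actions (`Match.step`). Suppose matched situations
-- undergo matched actions and one successor is bounded by `b`. If a fluent of the other successor
-- held of a tuple with an entry outside the matching, that entry could be replaced by any of `b`
-- unused objects on the bounded side, giving `b` tuples there (`Match.exists_many`), a
-- contradiction. So under boundedness no action brings in objects beyond the constants, the active
-- domain and its own arguments, and the old matching still matches the successors. Restricting it
-- to the constants and the new active domain (`Match.exists_restriction`) keeps its size bounded
-- along all runs.
--
-- Hence every bounded situation is represented by a finite set of facts over the first `objBound x`
-- numbers, coded by a bitmask. Boundedness of the theory amounts to the existence of a set of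
-- bounded coded states that contains all bounded initial ones and is closed under possible actions
-- (`Invariant`). Such a set yields boundedness by induction on situations
-- (`isBounded_of_invariant`). Conversely, if the theory is bounded, the coded states representing
-- executable situations of models form such a set (`invariant_of_isBounded`); coded initial states
-- are realised in the tree of action sequences (`exists_model_represents`).
--
-- All quantifiers in `Invariant` are bounded. Formulas are evaluated in coded states over all of
-- `ℕ`, and the same back-and-forth argument bounds the search for witnesses (`exObj_holds_iff`,
-- `exAct_holds_iff`), so the test is primitive recursive.

universe v

namespace SitCalc

/-! ### Finite partial bijections -/

/-- A finite relation that is functional and injective. -/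
def BiUnique {X : Type u} {Y : Type v} (p : Finset (X × Y)) : Prop :=
  ∀ a ∈ p, ∀ b ∈ p, a.1 = b.1 ↔ a.2 = b.2

/-- The converse of a finite relation. -/
def converse {X : Type u} {Y : Type v} (p : Finset (X × Y)) : Finset (Y × X) :=
  p.map (Equiv.prodComm X Y).toEmbedding

section PartialBijections

variable {X : Type u} {Y : Type v} {p : Finset (X × Y)}

@[simp] theorem mem_converse {q : Y × X} : q ∈ converse p ↔ (q.2, q.1) ∈ p := by
  obtain ⟨y, x⟩ := q
  simp [converse]

@[simp] theorem card_converse : (converse p).card = p.card := Finset.card_map _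

theorem BiUnique.converse (hp : BiUnique p) : BiUnique (converse p) := by
  intro a ha b hb
  exact (hp _ (mem_converse.1 ha) _ (mem_converse.1 hb)).symm

theorem BiUnique.mono {q : Finset (X × Y)} (hp : BiUnique p) (h : q ⊆ p) : BiUnique q :=
  fun a ha b hb => hp a (h ha) b (h hb)

theorem BiUnique.eq_iff (hp : BiUnique p) {x x' : X} {y y' : Y} (h : (x, y) ∈ p)
    (h' : (x', y') ∈ p) : x = x' ↔ y = y' := hp _ h _ h'

open Classical in
theorem BiUnique.insert (hp : BiUnique p) {x : X} {y : Y} (hx : ∀ y, (x, y) ∉ p)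
    (hy : ∀ x, (x, y) ∉ p) : BiUnique (insert (x, y) p) := by
  rintro ⟨a, a'⟩ ha ⟨b, b'⟩ hb
  simp only [Finset.mem_insert, Prod.mk.injEq] at ha hb
  rcases ha with ⟨rfl, rfl⟩ | ha <;> rcases hb with ⟨rfl, rfl⟩ | hb
  · simp
  · constructor
    · rintro rfl; exact absurd hb (hx _)
    · rintro rfl; exact absurd hb (hy _)
  · constructor
    · rintro rfl; exact absurd ha (hx _)
    · rintro rfl; exact absurd ha (hy _)
  · exact hp.eq_iff ha hb

/-- A finite partial bijection extends to any finite set, with the new values in a set that is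
large enough. -/
theorem BiUnique.exists_extension (hp : BiUnique p) (s : Finset X) (T : Finset Y)
    (h : p.card + s.card ≤ T.card) :
    ∃ p', p ⊆ p' ∧ BiUnique p' ∧ p'.card ≤ p.card + s.card ∧
      (∀ q ∈ p', q ∈ p ∨ (q.1 ∈ s ∧ q.2 ∈ T)) ∧ ∀ x ∈ s, ∃ y, (x, y) ∈ p' := by
  classical
  induction s using Finset.induction_on with
  | empty => exact ⟨p, subset_rfl, hp, by simp, fun q hq => Or.inl hq, by simp⟩
  | insert x s hx ih =>
    rw [Finset.card_insert_of_notMem hx] at h ⊢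
    obtain ⟨p₁, h1, h2, h3, h4, h5⟩ := ih (by omega)
    by_cases hd : ∃ y, (x, y) ∈ p₁
    · refine ⟨p₁, h1, h2, by omega, fun q hq => ?_, fun z hz => ?_⟩
      · exact (h4 q hq).imp_right fun h => ⟨Finset.mem_insert_of_mem h.1, h.2⟩
      · rcases Finset.mem_insert.1 hz with rfl | hz
        exacts [hd, h5 z hz]
    · push Not at hd
      -- The partners used so far number at most `p.card + s.card`, one less than the size
      -- guaranteed for `T`.
      obtain ⟨y, hyT, hy⟩ : ∃ y ∈ T, y ∉ p₁.image Prod.snd :=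
        Finset.exists_mem_notMem_of_card_lt_card
          (lt_of_le_of_lt Finset.card_image_le (by omega))
      refine ⟨Insert.insert (x, y) p₁, h1.trans (Finset.subset_insert _ _),
        h2.insert hd fun z hz => hy (Finset.mem_image_of_mem Prod.snd hz), ?_, ?_, ?_⟩
      · exact (Finset.card_insert_le _ _).trans (by omega)
      · intro q hq
        rcases Finset.mem_insert.1 hq with rfl | hq
        · exact Or.inr ⟨Finset.mem_insert_self _ _, hyT⟩
        · exact (h4 q hq).imp_right fun h => ⟨Finset.mem_insert_of_mem h.1, h.2⟩
      · intro z hz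
        rcases Finset.mem_insert.1 hz with rfl | hz
        · exact ⟨y, Finset.mem_insert_self _ _⟩
        · obtain ⟨w, hw⟩ := h5 z hz
          exact ⟨w, Finset.mem_insert_of_mem hw⟩

theorem BiUnique.exists_extension_tuple (hp : BiUnique p) {k : ℕ} (z : Fin k → X) (T : Finset Y)
    (h : p.card + k ≤ T.card) :
    ∃ p', p ⊆ p' ∧ BiUnique p' ∧ p'.card ≤ p.card + k ∧
      (∀ q ∈ p', q ∈ p ∨ ((∃ i, z i = q.1) ∧ q.2 ∈ T)) ∧ ∃ y : Fin k → Y, ∀ i, (z i, y i) ∈ p' := by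
  classical
  have hc : (Finset.univ.image z).card ≤ k := Finset.card_image_le.trans (by simp)
  obtain ⟨p', h1, h2, h3, h4, h5⟩ := hp.exists_extension (Finset.univ.image z) T (by omega)
  choose y hy using fun i => h5 (z i) (Finset.mem_image_of_mem z (Finset.mem_univ i))
  exact ⟨p', h1, h2, by omega, fun q hq => (h4 q hq).imp_right fun h => ⟨by simpa using h.1, h.2⟩,
    y, hy⟩

theorem BiUnique.exists_extension_tuple_infinite [Infinite Y] (hp : BiUnique p) {k : ℕ}
    (z : Fin k → X) :
    ∃ p', p ⊆ p' ∧ BiUnique p' ∧ ∃ y : Fin k → Y, ∀ i, (z i, y i) ∈ p' := by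
  obtain ⟨T, hT⟩ := Infinite.exists_subset_card_eq Y (p.card + k)
  obtain ⟨p', h1, h2, -, -, h5⟩ := hp.exists_extension_tuple z T hT.ge
  exact ⟨p', h1, h2, h5⟩

theorem converse_subset_iff {q : Finset (Y × X)} : p ⊆ converse q ↔ converse p ⊆ q := by
  constructor
  · intro h a ha
    simpa using h (mem_converse.1 ha)
  · intro h a ha
    rw [mem_converse]
    exact h (by simpa using ha)

end PartialBijections

/-! ### Size of codes -/

theorem lt_pair_of_pos {a b : ℕ} (h : 0 < a) : b < Nat.pair a b :=
  lt_of_lt_of_le (by omega) (Nat.add_le_pair a b)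

theorem le_encode_of_mem {l : List ℕ} {a : ℕ} (h : a ∈ l) : a < Encodable.encode l := by
  induction l with
  | nil => simp at h
  | cons b l ih =>
    rw [Encodable.encode_list_cons, Nat.lt_succ_iff]
    rcases List.mem_cons.1 h with rfl | h
    · exact Nat.left_le_pair _ _
    · exact (ih h).le.trans (Nat.right_le_pair _ _)

theorem length_le_encode (l : List ℕ) : l.length ≤ Encodable.encode l := by
  induction l with
  | nil => simp
  | cons b l ih =>
    rw [Encodable.encode_list_cons, List.length_cons]
    exact Nat.succ_le_succ (ih.trans (Nat.right_le_pair _ _))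

/-- Tuples of object terms have codes above those of their entries. -/
theorem code_lt_tupleCode {n k : ℕ} (ts : Fin k → ObjTerm n) (i : Fin k) :
    (ts i).code < tupleCode ts :=
  le_encode_of_mem (List.mem_ofFn.2 ⟨i, rfl⟩)

/-! ### Matching situations and transfer of truth -/

variable {S : Signature}

/-- A finite partial bijection that respects the first `C` constants and the fluents in the given
situations, and is defined on all objects occurring in the extensions of fluents. -/
structure Match (M : Interp.{u} S) (N : Interp.{v} S) (s : M.Sit) (t : N.Sit) (C : ℕ)
    (p : Finset (M.Obj × N.Obj)) : Prop where
  biUnique : BiUnique p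
  const : ∀ c < C, (M.const c, N.const c) ∈ p
  fluent_iff : ∀ (F : S.Fluent) x y, (∀ i, (x i, y i) ∈ p) → (M.fluent F x s ↔ N.fluent F y t)
  left : ∀ (F : S.Fluent) x, M.fluent F x s → ∀ i, ∃ y, (x i, y) ∈ p
  right : ∀ (F : S.Fluent) y, N.fluent F y t → ∀ i, ∃ x, (x, y i) ∈ p

/-- Two actions are related when they have the same type and related arguments. -/
def RelAct (M : Interp.{u} S) (N : Interp.{v} S) (p : Finset (M.Obj × N.Obj)) (a : M.Act)
    (a' : N.Act) : Prop :=
  ∃ (A : S.ActionType) (x : Fin (S.actionArity A) → M.Obj) (y : Fin (S.actionArity A) → N.Obj),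
    a = M.action A x ∧ a' = N.action A y ∧ ∀ i, (x i, y i) ∈ p

section Transfer

variable {M : Interp.{u} S} {N : Interp.{v} S} {s : M.Sit} {t : N.Sit} {C : ℕ}
  {p q : Finset (M.Obj × N.Obj)}

theorem Match.converse (h : Match M N s t C p) : Match N M t s C (converse p) where
  biUnique := h.biUnique.converse
  const c hc := mem_converse.2 (h.const c hc)
  fluent_iff F x y hxy := (h.fluent_iff F y x fun i => mem_converse.1 (hxy i)).symm
  left F x hx i := (h.right F x hx i).imp fun _ h => mem_converse.2 h
  right F y hy i := (h.left F y hy i).imp fun _ h => mem_converse.2 h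

/-- Added pairs cannot affect the fluents: a tuple in a fluent already has partners under `p`, and
biuniqueness of `q` leaves no others. -/
theorem Match.mono (h : Match M N s t C p) (hpq : p ⊆ q) (hq : BiUnique q) :
    Match M N s t C q where
  biUnique := hq
  const c hc := hpq (h.const c hc)
  fluent_iff F x y hxy := by
    constructor
    · intro hx
      choose z hz using h.left F x hx
      have : y = z := funext fun i => (hq.eq_iff (hxy i) (hpq (hz i))).1 rfl
      exact (h.fluent_iff F x y (this ▸ hz)).1 hx
    · intro hy
      choose z hz using h.right F y hy
      have : x = z := funext fun i => (hq.eq_iff (hxy i) (hpq (hz i))).2 rfl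
      exact (h.fluent_iff F x y (this ▸ hz)).2 hy
  left F x hx i := (h.left F x hx i).imp fun _ h => hpq h
  right F y hy i := (h.right F y hy i).imp fun _ h => hpq h

theorem RelAct.converse {a : M.Act} {a' : N.Act} (h : RelAct M N p a a') :
    RelAct N M (SitCalc.converse p) a' a := by
  obtain ⟨A, x, y, h1, h2, h3⟩ := h
  exact ⟨A, y, x, h2, h1, fun i => mem_converse.2 (h3 i)⟩

theorem RelAct.mono {a : M.Act} {a' : N.Act} (h : RelAct M N p a a') (hpq : p ⊆ q) :
    RelAct M N q a a' := by
  obtain ⟨A, x, y, h1, h2, h3⟩ := h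
  exact ⟨A, x, y, h1, h2, fun i => hpq (h3 i)⟩

theorem ObjTerm.eval_rel (hc : ∀ c < C, (M.const c, N.const c) ∈ p) {n : ℕ} (t : ObjTerm n)
    (ht : t.code < C) {v : Fin n → M.Obj} {v' : Fin n → N.Obj} (hv : ∀ i, (v i, v' i) ∈ p) :
    (t.eval M v, t.eval N v') ∈ p := by
  cases t with
  | var i => exact hv i
  | const c => exact hc c (lt_of_le_of_lt (Nat.right_le_pair 1 c) ht)

theorem ActTerm.eval_rel (hc : ∀ c < C, (M.const c, N.const c) ∈ p) {n m : ℕ} (t : ActTerm S n m)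
    (ht : t.code < C) {v : Fin n → M.Obj} {v' : Fin n → N.Obj} (hv : ∀ i, (v i, v' i) ∈ p)
    {w : Fin m → M.Act} {w' : Fin m → N.Act} (hw : ∀ i, RelAct M N p (w i) (w' i)) :
    RelAct M N p (t.eval M v w) (t.eval N v' w') := by
  cases t with
  | var i => exact hw i
  | app A ts =>
    refine ⟨A, _, _, rfl, rfl, fun i => ObjTerm.eval_rel hc _ ?_ hv⟩
    have h1 := code_lt_tupleCode ts i
    have h2 := Nat.right_le_pair A (tupleCode ts)
    have h3 := Nat.right_le_pair 1 (Nat.pair A (tupleCode ts))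
    simp only [ActTerm.code] at ht
    omega

/-- Unique names for actions reduce equality of actions to equality of types and of arguments, which
a partial bijection respects. -/
theorem RelAct.eq_iff (hp : BiUnique p) (hM : M.ActionAxioms) (hN : N.ActionAxioms)
    {a b : M.Act} {a' b' : N.Act} (ha : RelAct M N p a a') (hb : RelAct M N p b b') :
    a = b ↔ a' = b' := by
  obtain ⟨A, x, y, rfl, rfl, h⟩ := ha
  obtain ⟨B, z, w, rfl, rfl, h'⟩ := hb
  by_cases hAB : A = B
  · subst hAB
    constructor
    · intro e
      have := hM.args_inj _ _ _ e
      subst this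
      rw [show y = w from funext fun i => (hp.eq_iff (h i) (h' i)).1 rfl]
    · intro e
      have := hN.args_inj _ _ _ e
      subst this
      rw [show x = z from funext fun i => (hp.eq_iff (h i) (h' i)).2 rfl]
  · exact ⟨fun e => absurd e (hM.names_ne _ _ _ _ hAB),
      fun e => absurd e (hN.names_ne _ _ _ _ hAB)⟩

/-- Matching extends along any element. -/
theorem Match.exists_extension_tuple [Infinite N.Obj] (h : Match M N s t C p) {k : ℕ}
    (z : Fin k → M.Obj) :
    ∃ p', p ⊆ p' ∧ Match M N s t C p' ∧ ∃ y : Fin k → N.Obj, ∀ i, (z i, y i) ∈ p' := by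
  obtain ⟨p', h1, h2, h3⟩ := h.biUnique.exists_extension_tuple_infinite z
  exact ⟨p', h1, h.mono h1 h2, h3⟩

theorem Match.exists_extension_tuple_right [Infinite M.Obj] (h : Match M N s t C p) {k : ℕ}
    (y : Fin k → N.Obj) :
    ∃ p', p ⊆ p' ∧ Match M N s t C p' ∧ ∃ z : Fin k → M.Obj, ∀ i, (z i, y i) ∈ p' := by
  obtain ⟨q, h1, h2, z, hz⟩ := h.converse.exists_extension_tuple y
  refine ⟨SitCalc.converse q, converse_subset_iff.2 h1, h2.converse, z, fun i => ?_⟩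
  exact mem_converse.2 (hz i)

theorem forall_cons_rel {A : Type u} {B : Type v} {r : A → B → Prop} {n : ℕ} {v : Fin n → A}
    {v' : Fin n → B} {x : A} {x' : B} (hx : r x x') (hv : ∀ i, r (v i) (v' i)) (i : Fin (n + 1)) :
    r ((Fin.cons x v : Fin (n + 1) → A) i) ((Fin.cons x' v' : Fin (n + 1) → B) i) := by
  refine Fin.cases ?_ (fun j => ?_) i
  · simpa using hx
  · simpa using hv j

/-- Matching situations satisfy the same formulas under related assignments. -/
theorem Match.holds_iff [Infinite M.Obj] [Infinite N.Obj] (hM : M.ActionAxioms)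
    (hN : N.ActionAxioms) {n m : ℕ} (φ : Formula S n m) :
    ∀ {p : Finset (M.Obj × N.Obj)}, Match M N s t C p → φ.code < C →
      ∀ {v : Fin n → M.Obj} {v' : Fin n → N.Obj}, (∀ i, (v i, v' i) ∈ p) →
      ∀ {w : Fin m → M.Act} {w' : Fin m → N.Act}, (∀ i, RelAct M N p (w i) (w' i)) →
        (φ.Holds M s v w ↔ φ.Holds N t v' w') := by
  -- Codes dominate the codes of subterms and subformulas, so every constant met in the induction
  -- has index below `C` and is matched. The matching is universally quantified because quantifiers
  -- enlarge it.
  induction φ with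
  | objEq t₁ t₂ =>
    intro p h hC v v' hv w w' _
    have h0 := Nat.right_le_pair 0 (Nat.pair t₁.code t₂.code)
    have h1 := Nat.left_le_pair t₁.code t₂.code
    have h2 := Nat.right_le_pair t₁.code t₂.code
    simp only [Formula.code] at hC
    exact h.biUnique.eq_iff (t₁.eval_rel h.const (by omega) hv)
      (t₂.eval_rel h.const (by omega) hv)
  | actEq t₁ t₂ =>
    intro p h hC v v' hv w w' hw
    have h0 := Nat.right_le_pair 1 (Nat.pair t₁.code t₂.code)
    have h1 := Nat.left_le_pair t₁.code t₂.code
    have h2 := Nat.right_le_pair t₁.code t₂.code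
    simp only [Formula.code] at hC
    exact RelAct.eq_iff h.biUnique hM hN (t₁.eval_rel h.const (by omega) hv hw)
      (t₂.eval_rel h.const (by omega) hv hw)
  | fluent F ts =>
    intro p h hC v v' hv w w' hw
    refine h.fluent_iff F _ _ fun i => (ts i).eval_rel h.const ?_ hv
    have h1 := code_lt_tupleCode ts i
    have h2 := Nat.right_le_pair F (tupleCode ts)
    have h3 := Nat.right_le_pair 2 (Nat.pair F (tupleCode ts))
    simp only [Formula.code] at hC
    omega
  | not φ ih =>
    intro p h hC v v' hv w w' hw
    exact not_congr (ih h ((Nat.right_le_pair 3 _).trans_lt hC) hv hw)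
  | and φ ψ ih₁ ih₂ =>
    intro p h hC v v' hv w w' hw
    have h0 := Nat.right_le_pair 4 (Nat.pair φ.code ψ.code)
    have h1 := Nat.left_le_pair φ.code ψ.code
    have h2 := Nat.right_le_pair φ.code ψ.code
    simp only [Formula.code] at hC
    exact and_congr (ih₁ h (by omega) hv hw) (ih₂ h (by omega) hv hw)
  | exObj φ ih =>
    intro p h hC v v' hv w w' hw
    have hC' := (Nat.right_le_pair 5 _).trans_lt hC
    constructor
    · rintro ⟨x, hx⟩
      obtain ⟨p', hp, h', y, hy⟩ := h.exists_extension_tuple (fun _ : Fin 1 => x)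
      exact ⟨y 0, (ih h' hC' (forall_cons_rel (r := fun a b => (a, b) ∈ p') (hy 0)
        fun i => hp (hv i)) fun i => (hw i).mono hp).1 hx⟩
    · rintro ⟨y, hy⟩
      obtain ⟨p', hp, h', x, hx⟩ := h.exists_extension_tuple_right (fun _ : Fin 1 => y)
      exact ⟨x 0, (ih h' hC' (forall_cons_rel (r := fun a b => (a, b) ∈ p') (hx 0)
        fun i => hp (hv i)) fun i => (hw i).mono hp).2 hy⟩
  | exAct φ ih =>
    intro p h hC v v' hv w w' hw
    have hC' := (Nat.right_le_pair 6 _).trans_lt hC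
    constructor
    · rintro ⟨a, ha⟩
      -- Domain closure turns an action quantifier into a choice of type and finitely many objects.
      obtain ⟨A, z, rfl⟩ := hM.closure a
      obtain ⟨p', hp, h', y, hy⟩ := h.exists_extension_tuple z
      exact ⟨N.action A y, (ih h' hC' (fun i => hp (hv i))
        (forall_cons_rel ⟨A, z, y, rfl, rfl, hy⟩ fun i => (hw i).mono hp)).1 ha⟩
    · rintro ⟨a, ha⟩
      obtain ⟨A, y, rfl⟩ := hN.closure a
      obtain ⟨p', hp, h', z, hz⟩ := h.exists_extension_tuple_right y
      exact ⟨M.action A z, (ih h' hC' (fun i => hp (hv i))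
        (forall_cons_rel ⟨A, z, y, rfl, rfl, hz⟩ fun i => (hw i).mono hp)).2 ha⟩

end Transfer

/-! ### Successor situations -/

section Step

variable {M : Interp.{u} S} {N : Interp.{v} S} {s s₂ : M.Sit} {t t₂ : N.Sit} {C : ℕ}
  {p : Finset (M.Obj × N.Obj)}

/-- If a formula holds of a tuple with an entry outside the domain of a matching, then it holds of
many tuples on the other side. -/
theorem Match.exists_many [Infinite M.Obj] [Infinite N.Obj] (h : Match M N s t C p)
    (hM : M.ActionAxioms) (hN : N.ActionAxioms) {n m : ℕ} (φ : Formula S n m) (hC : φ.code < C)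
    {x : Fin n → M.Obj} {w : Fin m → M.Act} {w' : Fin m → N.Act}
    (hw : ∀ i, RelAct M N p (w i) (w' i)) (hx : φ.Holds M s x w) (i : Fin n)
    (hi : ∀ y, (x i, y) ∉ p) (T : Finset N.Obj) (b : ℕ) (hT : p.card + n + b ≤ T.card) :
    ∃ Y : Fin b → Fin n → N.Obj, Function.Injective Y ∧
      (∀ k j, Y k j ∈ T ∨ ∃ x, (x, Y k j) ∈ p) ∧ ∀ k, φ.Holds N t (Y k) w' := by
  classical
  have hcard : ((Finset.univ.image x).erase (x i)).card ≤ n :=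
    (Finset.card_le_card (Finset.erase_subset _ _)).trans
      (Finset.card_image_le.trans (by simp))
  -- All entries other than `x i` receive partners first; `x i` itself stays free.
  obtain ⟨p₁, h1, h2, h3, h4, h5⟩ :=
    h.biUnique.exists_extension ((Finset.univ.image x).erase (x i)) T (by omega)
  have hi₁ : ∀ y, (x i, y) ∉ p₁ := fun y hy => by
    rcases h4 _ hy with hy | hy
    · exact hi y hy
    · exact (Finset.mem_erase.1 hy.1).1 rfl
  have h6 : ∀ j, x j ≠ x i → ∃ y, (x j, y) ∈ p₁ := fun j hj =>
    h5 _ (Finset.mem_erase.2 ⟨hj, Finset.mem_image_of_mem _ (Finset.mem_univ _)⟩)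
  choose y hy using h6
  -- At most `p.card + n` elements of `T` are used up, so `b` remain as possible partners of `x i`.
  have hT' : b ≤ (T \ p₁.image Prod.snd).card := by
    have := Finset.le_card_sdiff (p₁.image Prod.snd) T
    have h7 : (p₁.image Prod.snd).card ≤ p₁.card := Finset.card_image_le
    omega
  let e : Fin b → N.Obj := fun k =>
    ((T \ p₁.image Prod.snd).equivFin.symm (Fin.castLE hT' k) : N.Obj)
  have he : Function.Injective e := fun k l hkl => by
    simpa using (T \ p₁.image Prod.snd).equivFin.symm.injective (Subtype.ext hkl)
  have heT : ∀ k, e k ∈ T ∧ ∀ z, (z, e k) ∉ p₁ := fun k => by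
    have := Finset.mem_sdiff.1 ((T \ p₁.image Prod.snd).equivFin.symm (Fin.castLE hT' k)).2
    exact ⟨this.1, fun z hz => this.2 (Finset.mem_image_of_mem Prod.snd hz)⟩
  -- Every position holding the value `x i` must change together for the tuple to stay related;
  -- position `i` alone shows that the tuples differ.
  refine ⟨fun k j => if hj : x j = x i then e k else y j hj, ?_, ?_, ?_⟩
  · intro k l hkl
    have := congrFun hkl i
    simp only [dite_true] at this
    exact he this
  · intro k j
    by_cases hj : x j = x i
    · simp only [hj, dite_true]
      exact Or.inl (heT k).1
    · simp only [hj, dite_false]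
      rcases h4 _ (hy j hj) with hq | hq
      · exact Or.inr ⟨_, hq⟩
      · exact Or.inl hq.2
  · intro k
    have hq : BiUnique (insert (x i, e k) p₁) := h2.insert hi₁ (heT k).2
    have hpq : p ⊆ insert (x i, e k) p₁ := h1.trans (Finset.subset_insert _ _)
    refine ((h.mono hpq hq).holds_iff hM hN φ hC (fun j => ?_) fun j => (hw j).mono hpq).1 hx
    by_cases hj : x j = x i
    · simp [hj]
    · simp only [hj, dite_false]
      exact Finset.mem_insert_of_mem (hy j hj)

/-- The fluents in `s₂` are those produced in `s` by the action `a` with the successor state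
formulas `φ`, as far as tuples over `U` are concerned; no other tuples occur in `s₂`. -/
def StepOn (M : Interp.{u} S) (φ : ∀ F : S.Fluent, Formula S (S.fluentArity F) 1) (s s₂ : M.Sit)
    (a : M.Act) (U : Set M.Obj) : Prop :=
  ∀ F x, M.fluent F x s₂ ↔ (∀ i, x i ∈ U) ∧ (φ F).Holds M s x (fun _ => a)

variable {φ : ∀ F : S.Fluent, Formula S (S.fluentArity F) 1} {a : M.Act} {a' : N.Act}
  {U : Set M.Obj} {V : Set N.Obj} {b L : ℕ}

/-- An unmatched entry in a successor fact would yield `b` facts of the same fluent on the bounded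
side. The fresh entries are taken in `T`, inside `V`, so that these facts survive the truncation to
`V`. -/
theorem Match.step_left [Infinite M.Obj] [Infinite N.Obj] (h : Match M N s t C p)
    (hM : M.ActionAxioms) (hN : N.ActionAxioms) (hC : ∀ F, (φ F).code < C)
    (ha : RelAct M N p a a') (hs : StepOn M φ s s₂ a U) (ht : StepOn N φ t t₂ a' V)
    (hV : ∀ q ∈ p, q.2 ∈ V) (hL : ∀ F, S.fluentArity F ≤ L)
    (T : Finset N.Obj) (hTV : ∀ z ∈ T, z ∈ V) (hT : p.card + L + b ≤ T.card)
    (hb : N.Bounded b t₂) (F : S.Fluent) (x : Fin (S.fluentArity F) → M.Obj)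
    (hx : M.fluent F x s₂) (i : Fin (S.fluentArity F)) : ∃ y, (x i, y) ∈ p := by
  by_contra! hi
  have := hL F
  obtain ⟨Y, h1, h2, h3⟩ := h.exists_many hM hN (φ F) (hC F) (fun _ => ha) ((hs F x).1 hx).2 i hi
    T b (by omega)
  refine hb F ⟨Y, fun k => (ht F _).2 ⟨fun j => ?_, h3 k⟩, fun k l hkl => h1.ne hkl⟩
  rcases h2 k j with h4 | ⟨z, hz⟩
  exacts [hTV _ h4, hV _ hz]

/-- The matching maps the tuples of each fluent injectively to tuples of the same fluent. -/
theorem Match.bounded_left (h : Match M N s t C p) (hb : N.Bounded b t) : M.Bounded b s := by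
  rintro F ⟨x, h1, h2⟩
  have hex : ∀ k, ∃ y : Fin (S.fluentArity F) → N.Obj, ∀ i, (x k i, y i) ∈ p := fun k => by
    choose y hy using h.left F _ (h1 k)
    exact ⟨y, hy⟩
  choose y hy using hex
  refine hb F ⟨y, fun k => (h.fluent_iff F _ _ (hy k)).1 (h1 k), fun k l hkl e => h2 k l hkl ?_⟩
  funext i
  exact (h.biUnique.eq_iff (hy k i) (hy l i)).2 (congrFun e i)

theorem Match.bounded_right (h : Match M N s t C p) (hb : M.Bounded b s) : N.Bounded b t :=
  h.converse.bounded_left hb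

/-- Matching situations have matching successors, as soon as one of these is bounded. -/
theorem Match.step [Infinite M.Obj] [Infinite N.Obj] (h : Match M N s t C p)
    (hM : M.ActionAxioms) (hN : N.ActionAxioms) (hC : ∀ F, (φ F).code < C)
    (ha : RelAct M N p a a') (hs : StepOn M φ s s₂ a U) (ht : StepOn N φ t t₂ a' V)
    (hU : ∀ q ∈ p, q.1 ∈ U) (hV : ∀ q ∈ p, q.2 ∈ V) (hL : ∀ F, S.fluentArity F ≤ L)
    (T : Finset N.Obj) (hTV : ∀ z ∈ T, z ∈ V) (hT : p.card + L + b ≤ T.card)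
    (T' : Finset M.Obj) (hTU : ∀ z ∈ T', z ∈ U) (hT' : p.card + L + b ≤ T'.card)
    (hb : N.Bounded b t₂) : Match M N s₂ t₂ C p := by
  have hl := h.step_left hM hN hC ha hs ht hV hL T hTV hT hb
  have hiff : ∀ (F : S.Fluent) x y, (∀ i, (x i, y i) ∈ p) →
      (M.fluent F x s₂ ↔ N.fluent F y t₂) := fun F x y hxy => by
    rw [hs F x, ht F y]
    exact and_congr (iff_of_true (fun i => hU _ (hxy i)) fun i => hV _ (hxy i))
      (h.holds_iff hM hN (φ F) (hC F) hxy fun _ => ha)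
  -- The bound is first carried over to `s₂`, because covering the active domain of `t₂` uses
  -- `step_left` in the opposite direction and needs a bound on this side.
  have hMb : M.Bounded b s₂ := by
    rintro F ⟨x, h1, h2⟩
    have hex : ∀ k, ∃ y : Fin (S.fluentArity F) → N.Obj, ∀ i, (x k i, y i) ∈ p := fun k => by
      choose y hy using hl F _ (h1 k)
      exact ⟨y, hy⟩
    choose y hy using hex
    refine hb F ⟨y, fun k => (hiff F _ _ (hy k)).1 (h1 k), fun k l hkl e => h2 k l hkl ?_⟩
    funext i
    exact (h.biUnique.eq_iff (hy k i) (hy l i)).2 (congrFun e i)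
  refine ⟨h.biUnique, h.const, hiff, hl, fun F y hy i => ?_⟩
  obtain ⟨z, hz⟩ := h.converse.step_left hN hM hC ha.converse ht hs
    (fun q hq => hU _ (mem_converse.1 hq)) hL T' hTU (by simpa using hT') hMb F y hy i
  exact ⟨z, mem_converse.1 hz⟩

end Step

/-! ### Active domains -/

/-- There are at most `K` fluents, each with at most `K` tuples of at most `K` entries. -/
theorem exists_activeDomain {M : Interp.{u} S} {s : M.Sit} {b K : ℕ} (hb : M.Bounded b s)
    (hF : S.fluentArities.length ≤ K) (hK : b ≤ K) (hL : ∀ F, S.fluentArity F ≤ K) :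
    ∃ A : Finset M.Obj, A.card ≤ K * (K * K) ∧
      ∀ (F : S.Fluent) x, M.fluent F x s → ∀ i, x i ∈ A := by
  classical
  have hfin : ∀ F : S.Fluent, ∃ E : Finset (Fin (S.fluentArity F) → M.Obj), E.card ≤ K ∧
      ∀ x, M.fluent F x s → x ∈ E := by
    intro F
    by_contra! hcon
    -- If no set of at most `K` tuples exhausts the fluent, sets of its tuples grow one element at a
    -- time up to the forbidden size `b`.
    have hind : ∀ k ≤ b, ∃ E : Finset (Fin (S.fluentArity F) → M.Obj), E.card = k ∧
        ∀ x ∈ E, M.fluent F x s := by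
      intro k
      induction k with
      | zero => exact fun _ => ⟨∅, by simp⟩
      | succ k ih =>
        intro hk
        obtain ⟨E, h1, h2⟩ := ih (by omega)
        obtain ⟨x, hx, hxE⟩ := hcon E (by omega)
        refine ⟨insert x E, by rw [Finset.card_insert_of_notMem hxE, h1], fun z hz => ?_⟩
        rcases Finset.mem_insert.1 hz with rfl | hz
        exacts [hx, h2 z hz]
    obtain ⟨E, h1, h2⟩ := hind b le_rfl
    subst h1
    refine hb F ⟨fun i => (E.equivFin.symm i : _), fun i => h2 _ (E.equivFin.symm i).2,
      fun i j hij e => hij ?_⟩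
    exact E.equivFin.symm.injective (Subtype.ext e)
  choose E hE hE' using hfin
  refine ⟨Finset.univ.biUnion fun F => (E F).biUnion fun x => Finset.univ.image x, ?_, ?_⟩
  · refine (Finset.card_biUnion_le_card_mul _ _ (K * K) fun F _ => ?_).trans
      (Nat.mul_le_mul_right _ (by simpa using hF))
    refine (Finset.card_biUnion_le_card_mul _ _ K fun x _ => ?_).trans
      (Nat.mul_le_mul_right _ (hE F))
    exact Finset.card_image_le.trans (by simpa using hL F)
  · intro F x hx i
    simp only [Finset.mem_biUnion, Finset.mem_univ, true_and, Finset.mem_image]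
    exact ⟨F, x, hE' F x hx, i, rfl⟩

/-- A matching of bounded situations can be cut down to the first constants and the active
domain. -/
theorem Match.exists_restriction {M : Interp.{u} S} {N : Interp.{v} S} {s : M.Sit} {t : N.Sit}
    {C b K : ℕ} {p : Finset (M.Obj × N.Obj)} (h : Match M N s t C p) (hb : M.Bounded b s)
    (hF : S.fluentArities.length ≤ K) (hK : b ≤ K) (hL : ∀ F, S.fluentArity F ≤ K) :
    ∃ q ⊆ p, Match M N s t C q ∧ q.card ≤ C + K * (K * K) := by
  classical
  obtain ⟨A, hA, hA'⟩ := exists_activeDomain hb hF hK hL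
  let B : Finset M.Obj := (Finset.range C).image M.const ∪ A
  have hB : B.card ≤ C + K * (K * K) :=
    (Finset.card_union_le _ _).trans
      (add_le_add (Finset.card_image_le.trans (by simp)) hA)
  refine ⟨p.filter fun q => q.1 ∈ B, Finset.filter_subset _ _, ⟨?_, ?_, ?_, ?_, ?_⟩, ?_⟩
  · exact h.biUnique.mono (Finset.filter_subset _ _)
  · intro c hc
    exact Finset.mem_filter.2 ⟨h.const c hc, Finset.mem_union_left _
      (Finset.mem_image_of_mem _ (Finset.mem_range.2 hc))⟩
  · exact fun F x y hxy => h.fluent_iff F x y fun i => (Finset.mem_filter.1 (hxy i)).1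
  · intro F x hx i
    obtain ⟨y, hy⟩ := h.left F x hx i
    exact ⟨y, Finset.mem_filter.2 ⟨hy, Finset.mem_union_right _ (hA' F x hx i)⟩⟩
  · intro F y hy i
    choose x hx using h.right F y hy
    have := (h.fluent_iff F x y hx).2 hy
    exact ⟨x i, Finset.mem_filter.2 ⟨hx i, Finset.mem_union_right _ (hA' F x this i)⟩⟩
  -- A partial bijection is no larger than its domain, here contained in `B`.
  · refine le_trans (Finset.card_le_card_of_injOn Prod.fst ?_ ?_) hB
    · intro q hq
      exact (Finset.mem_filter.1 hq).2
    · intro q hq r hr hqr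
      have hq' := (Finset.mem_filter.1 hq).1
      have hr' := (Finset.mem_filter.1 hr).1
      exact Prod.ext hqr ((h.biUnique q hq' r hr').1 hqr)

/-! ### Executable situations -/

section Executable

variable {M : Interp.{u} S}

theorem Interp.Foundational.executable_s0 (h : M.Foundational) : M.Executable M.s0 := by
  rintro a s (hs | hs)
  · exact absurd hs (h.not_before_s0 _)
  · exact absurd (hs ▸ (h.before_do a s s).2 (Or.inr rfl)) (h.not_before_s0 s)

theorem Interp.Foundational.executable_do_iff (h : M.Foundational) (a : M.Act) (s : M.Sit) :
    M.Executable (M.doAct a s) ↔ M.Executable s ∧ M.Poss a s := by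
  constructor
  · intro hs
    exact ⟨fun a' s' hs' => hs a' s' (Or.inl ((h.before_do _ _ _).2 hs')), hs a s (Or.inr rfl)⟩
  · rintro ⟨h1, h2⟩ a' s' (hs' | hs')
    · exact h1 a' s' ((h.before_do _ _ _).1 hs')
    · obtain ⟨rfl, rfl⟩ := h.do_inj _ _ _ _ hs'
      exact h2

end Executable

/-! ### Models with a prescribed initial state -/

/-- Ground actions over a copy of the natural numbers. -/
abbrev GroundAct (S : Signature) : Type u :=
  Σ A : S.ActionType, Fin (S.actionArity A) → ULift.{u} ℕ

/-- Extensions of all fluents over a copy of the natural numbers. -/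
abbrev State (S : Signature) : Type u :=
  ∀ F : S.Fluent, (Fin (S.fluentArity F) → ULift.{u} ℕ) → Prop

/-- The precedence relation on action sequences. -/
def listBefore {A : Type u} (s : List A) : List A → Prop
  | [] => False
  | _ :: t => listBefore s t ∨ s = t

/-- The interpretation on the tree of action sequences with given fluents and possibility
relation. -/
abbrev treeInterp (S : Signature) (fl : List (GroundAct.{u} S) → State.{u} S)
    (poss : GroundAct.{u} S → List (GroundAct.{u} S) → Prop) : Interp.{u} S where
  Obj := ULift.{u} ℕ
  Act := GroundAct.{u} S
  Sit := List (GroundAct.{u} S)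
  const := ULift.up
  action A x := ⟨A, x⟩
  s0 := []
  doAct := List.cons
  Before := listBefore
  Poss := poss
  fluent F x s := fl s F x

theorem treeInterp_objEval {fl fl' : List (GroundAct.{u} S) → State.{u} S}
    {poss poss' : GroundAct.{u} S → List (GroundAct.{u} S) → Prop} {n : ℕ} (t : ObjTerm n)
    (v : Fin n → ULift.{u} ℕ) :
    t.eval (treeInterp S fl poss) v = t.eval (treeInterp S fl' poss') v := by
  cases t <;> rfl

theorem treeInterp_actEval {fl fl' : List (GroundAct.{u} S) → State.{u} S}
    {poss poss' : GroundAct.{u} S → List (GroundAct.{u} S) → Prop} {n m : ℕ} (t : ActTerm S n m)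
    (v : Fin n → ULift.{u} ℕ) (w : Fin m → GroundAct.{u} S) :
    t.eval (treeInterp S fl poss) v w = t.eval (treeInterp S fl' poss') v w := by
  cases t with
  | var => rfl
  | app A ts =>
    exact congrArg (Sigma.mk A) (funext fun i => treeInterp_objEval (ts i) v)

/-- Uniform formulas see only the fluents of the current situation. This lets `BAT.stateAfter`
evaluate the successor state formulas in an auxiliary interpretation, where the later situations are
not yet defined, and still produce a model. -/
theorem treeInterp_holds_iff {fl fl' : List (GroundAct.{u} S) → State.{u} S}
    {poss poss' : GroundAct.{u} S → List (GroundAct.{u} S) → Prop}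
    {s s' : List (GroundAct.{u} S)} (h : fl s = fl' s') {n m : ℕ} (φ : Formula S n m) :
    ∀ (v : Fin n → ULift.{u} ℕ) (w : Fin m → GroundAct.{u} S),
      φ.Holds (treeInterp S fl poss) s v w ↔ φ.Holds (treeInterp S fl' poss') s' v w := by
  induction φ with
  | objEq t₁ t₂ =>
    intro v w
    exact iff_of_eq (congrArg₂ (@Eq (ULift.{u} ℕ)) (treeInterp_objEval t₁ v)
      (treeInterp_objEval t₂ v))
  | actEq t₁ t₂ =>
    intro v w
    exact iff_of_eq (congrArg₂ (@Eq (GroundAct.{u} S)) (treeInterp_actEval t₁ v w)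
      (treeInterp_actEval t₂ v w))
  | fluent F ts =>
    intro v w
    refine iff_of_eq ?_
    change fl s F _ = fl' s' F _
    rw [h, funext fun i => treeInterp_objEval (fl := fl) (fl' := fl') (ts i) v]
  | not φ ih => exact fun v w => not_congr (ih v w)
  | and φ ψ ih₁ ih₂ => exact fun v w => and_congr (ih₁ v w) (ih₂ v w)
  | exObj φ ih => exact fun v w => exists_congr fun x => ih (Fin.cons x v) w
  | exAct φ ih => exact fun v w => exists_congr fun a => ih v (Fin.cons a w)

/-- The state reached from `I` by a sequence of actions. -/
def BAT.stateAfter (D : BAT S) (I : State.{u} S) : List (GroundAct.{u} S) → State.{u} S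
  | [] => I
  | a :: s => fun F x =>
    (D.succState F).Holds (treeInterp S (fun _ => D.stateAfter I s) fun _ _ => False) [] x
      fun _ => a

/-- The tree of action sequences with initial state `I`. -/
def BAT.treeModel (D : BAT S) (I : State.{u} S) : Interp.{u} S :=
  treeInterp S (D.stateAfter I) fun a s =>
    (D.precond a.1).Holds (treeInterp S (fun _ => D.stateAfter I s) fun _ _ => False) [] a.2
      Fin.elim0

theorem BAT.actionAxioms_treeModel (D : BAT S) (I : State.{u} S) :
    (D.treeModel I).ActionAxioms where
  names_ne _ _ _ _ hA h := hA (congrArg Sigma.fst h)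
  args_inj _ _ _ h := eq_of_heq (Sigma.mk.inj h).2
  closure a := ⟨a.1, a.2, rfl⟩

theorem BAT.isModel_treeModel (D : BAT S) (I : State.{u} S)
    (h : ∀ φ ∈ D.initial, φ.Holds (D.treeModel I) (D.treeModel I).s0 Fin.elim0 Fin.elim0) :
    (D.treeModel I).IsModel D where
  initial := h
  precond A x s := treeInterp_holds_iff (fl := fun _ => D.stateAfter I s) (s := [])
    (fl' := D.stateAfter I) (s' := s) rfl (D.precond A) x Fin.elim0
  succState F x a s := treeInterp_holds_iff (fl := fun _ => D.stateAfter I s) (s := [])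
    (fl' := D.stateAfter I) (s' := s) rfl (D.succState F) x fun _ => a
  actionAxioms := D.actionAxioms_treeModel I
  uniqueNames := ULift.up_injective
  foundational :=
    { do_inj := fun a a' s s' h => by
        have := List.cons.inj h
        exact ⟨this.1, this.2⟩
      induction := fun P h0 h1 s => by
        induction s with
        | nil => exact h0
        | cons a s ih => exact h1 a s ih
      not_before_s0 := fun s h => h
      before_do := fun a s s' => Iff.rfl }

/-! ### Coded tuples and coded states -/

/-- The list of numbers with a given code. -/
abbrev listOf (k : ℕ) : List ℕ := Denumerable.ofNat (List ℕ) k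

/-- Code of a tuple of numbers. -/
def encTuple {n : ℕ} (z : Fin n → ℕ) : ℕ := Encodable.encode (List.ofFn z)

@[simp] theorem listOf_encode (l : List ℕ) : listOf (Encodable.encode l) = l :=
  Denumerable.ofNat_encode l

@[simp] theorem listOf_encTuple {k : ℕ} (z : Fin k → ℕ) : listOf (encTuple z) = List.ofFn z :=
  listOf_encode _

theorem lt_encTuple {k : ℕ} (z : Fin k → ℕ) (i : Fin k) : z i < encTuple z :=
  le_encode_of_mem (List.mem_ofFn.2 ⟨i, rfl⟩)

theorem encTuple_injective {n : ℕ} : Function.Injective (encTuple (n := n)) := fun _ _ h =>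
  List.ofFn_injective (Encodable.encode_injective h)

/-- The number `k` codes a pair of an index `i` into `ar` and a tuple of numbers below `K` whose
length is the `i`-th entry of `ar`. -/
def ValidTuple (ar : List ℕ) (K k : ℕ) : Prop :=
  k.unpair.1 < ar.length ∧ (listOf k.unpair.2).length = ar.getD k.unpair.1 0 ∧
    ∀ z ∈ listOf k.unpair.2, z < K

instance (ar : List ℕ) (K : ℕ) : DecidablePred (ValidTuple ar K) := fun k =>
  inferInstanceAs (Decidable (_ ∧ _ ∧ _))

theorem validTuple_iff {ar : List ℕ} {K k : ℕ} : ValidTuple ar K k ↔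
    ∃ (i : Fin ar.length) (z : Fin (ar.get i) → ℕ), k = Nat.pair i (encTuple z) ∧ ∀ j, z j < K := by
  constructor
  · rintro ⟨h1, h2, h3⟩
    have hl : (listOf k.unpair.2).length = ar.get ⟨k.unpair.1, h1⟩ := by
      rw [h2, List.getD_eq_getElem _ _ h1]; rfl
    refine ⟨⟨k.unpair.1, h1⟩, fun j => (listOf k.unpair.2).get (j.cast hl.symm), ?_,
      fun j => h3 _ (List.get_mem _ _)⟩
    have : encTuple (fun j => (listOf k.unpair.2).get (Fin.cast hl.symm j)) = k.unpair.2 := by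
      have h4 : List.ofFn (fun j => (listOf k.unpair.2).get (Fin.cast hl.symm j)) =
          listOf k.unpair.2 := by
        apply List.ext_get
        · simp [hl]
        · intro n h h'
          simp
      rw [encTuple, h4]
      exact Denumerable.encode_ofNat _
    rw [this, Nat.pair_unpair]
  · rintro ⟨i, z, rfl, h⟩
    refine ⟨?_, ?_, ?_⟩
    · simp
    · simp
    · simp only [Nat.unpair_pair, listOf_encTuple]
      intro a ha
      obtain ⟨j, rfl⟩ := List.mem_ofFn.1 ha
      exact h j

/-- A bound for the codes of pairs of an index up to `L` and a list of length at most `L` with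
entries up to `K`. -/
def codeBound (L K : ℕ) : ℕ :=
  Nat.pair L (Encodable.encode ((List.range L).map fun _ => K)) + 1

theorem pair_le_pair {a b c d : ℕ} (h : a ≤ c) (h' : b ≤ d) : Nat.pair a b ≤ Nat.pair c d := by
  refine le_trans (b := Nat.pair c b) ?_ ?_
  · rcases h.eq_or_lt with rfl | h
    exacts [le_rfl, (Nat.pair_lt_pair_left _ h).le]
  · rcases h'.eq_or_lt with rfl | h'
    exacts [le_rfl, (Nat.pair_lt_pair_right _ h').le]

/-- Pairing is monotone in both arguments, so the longest list with the largest entries has the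
largest code. -/
theorem encode_le_encode_replicate {K : ℕ} : ∀ {L : ℕ} (l : List ℕ), l.length ≤ L →
    (∀ z ∈ l, z ≤ K) → Encodable.encode l ≤ Encodable.encode (List.replicate L K)
  | _, [], _, _ => by simp
  | 0, a :: l, h, _ => by simp at h
  | L + 1, a :: l, h, h' => by
    rw [List.replicate_succ, Encodable.encode_list_cons, Encodable.encode_list_cons]
    refine Nat.succ_le_succ (pair_le_pair (h' a (by simp)) ?_)
    exact encode_le_encode_replicate l (by simpa using h) fun z hz => h' z (by simp [hz])

theorem ValidTuple.lt_codeBound {ar : List ℕ} {K k L : ℕ} (h : ValidTuple ar K k)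
    (h1 : ar.length ≤ L) (h2 : ∀ r ∈ ar, r ≤ L) : k < codeBound L K := by
  rw [codeBound, Nat.lt_succ_iff, ← Nat.pair_unpair k]
  refine pair_le_pair (h.1.le.trans h1) ?_
  rw [← Denumerable.encode_ofNat (α := List ℕ) k.unpair.2,
    show (List.range L).map (fun _ => K) = List.replicate L K by simp [List.map_const']]
  refine encode_le_encode_replicate _ ?_ fun z hz => (h.2.2 z hz).le
  refine h.2.1.le.trans (h2 _ ?_)
  rw [List.getD_eq_getElem _ _ h.1]
  exact List.getElem_mem _

/-- Membership of `k` in the finite set of numbers coded by the binary digits of `I`. -/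
def HasBit (I k : ℕ) : Prop := I / 2 ^ k % 2 = 1

instance (I : ℕ) : DecidablePred (HasBit I) := fun k => inferInstanceAs (Decidable (_ = _))

theorem hasBit_iff {I k : ℕ} : HasBit I k ↔ I.testBit k = true := by
  rw [Nat.testBit_eq_decide_div_mod_eq, decide_eq_true_iff, HasBit]

theorem HasBit.lt {I k : ℕ} (h : HasBit I k) : k < I :=
  lt_of_lt_of_le Nat.lt_two_pow_self (Nat.ge_two_pow_of_testBit (hasBit_iff.1 h))

open Classical in
theorem exists_hasBit_iff (W : ℕ) (P : ℕ → Prop) :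
    ∃ I < 2 ^ W, ∀ k, HasBit I k ↔ k < W ∧ P k := by
  refine ⟨Nat.ofBits fun i : Fin W => decide (P i), Nat.ofBits_lt_two_pow _, fun k => ?_⟩
  rw [hasBit_iff]
  by_cases hk : k < W
  · simp [Nat.testBit_ofBits_lt _ _ hk, hk]
  · simp [Nat.testBit_ofBits_ge _ _ (not_lt.1 hk), hk]

theorem HasBit.lt_of_lt_two_pow {I W k : ℕ} (h : HasBit I k) (hI : I < 2 ^ W) : k < W := by
  by_contra hk
  exact absurd (Nat.ge_two_pow_of_testBit (hasBit_iff.1 h))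
    (not_le.2 (hI.trans_le (Nat.pow_le_pow_right (by norm_num) (not_lt.1 hk))))

/-- The interpretation over the natural numbers in which situations are coded states: finite sets
of coded facts. -/
abbrev maskInterp (S : Signature) : Interp.{0} S where
  Obj := ℕ
  Act := Σ A : S.ActionType, Fin (S.actionArity A) → ℕ
  Sit := ℕ
  const := id
  action A x := ⟨A, x⟩
  s0 := 0
  doAct _ s := s
  Before _ _ := False
  Poss _ _ := False
  fluent F x I := HasBit I (Nat.pair F (encTuple x))

/-- Code of a ground action. -/
def actCode (a : (maskInterp S).Act) : ℕ := Nat.pair a.1 (encTuple a.2)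

theorem actCode_injective : Function.Injective (actCode (S := S)) := by
  rintro ⟨A, x⟩ ⟨B, y⟩ h
  obtain ⟨h1, h2⟩ := Nat.pair_eq_pair.1 h
  obtain rfl : A = B := Fin.ext h1
  exact congrArg (Sigma.mk A) (encTuple_injective h2)

theorem actionAxioms_maskInterp (S : Signature) : (maskInterp S).ActionAxioms where
  names_ne _ _ _ _ hA h := hA (congrArg Sigma.fst h)
  args_inj _ _ _ h := eq_of_heq (Sigma.mk.inj h).2
  closure a := ⟨a.1, a.2, rfl⟩

/-- A coded state exceeds its bit positions, and these exceed the objects in the facts they code. So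
`I` bounds its own active domain. -/
theorem lt_of_maskInterp_fluent {F : S.Fluent} {x : Fin (S.fluentArity F) → ℕ}
    {I : ℕ} (h : (maskInterp S).fluent F x I) (i : Fin (S.fluentArity F)) : x i < I :=
  (lt_encTuple x i).trans_le ((Nat.right_le_pair _ _).trans (HasBit.lt h).le)

/-- The identity on the numbers below `K`. -/
def idBelow (K : ℕ) : Finset (ℕ × ℕ) := (Finset.range K).image fun x => (x, x)

@[simp] theorem mem_idBelow {K : ℕ} {q : ℕ × ℕ} : q ∈ idBelow K ↔ q.1 < K ∧ q.1 = q.2 := by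
  obtain ⟨a, b⟩ := q
  simp only [idBelow, Finset.mem_image, Finset.mem_range, Prod.mk.injEq]
  constructor
  · rintro ⟨x, h, rfl, rfl⟩; exact ⟨h, rfl⟩
  · rintro ⟨h, rfl⟩; exact ⟨a, h, rfl, rfl⟩

theorem card_idBelow (K : ℕ) : (idBelow K).card = K := by
  rw [idBelow, Finset.card_image_of_injective _ fun a b h => (Prod.mk.inj h).1, Finset.card_range]

theorem biUnique_idBelow (K : ℕ) : BiUnique (idBelow K) := by
  intro a h b h'
  rw [(mem_idBelow.1 h).2, (mem_idBelow.1 h').2]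

theorem match_idBelow {I K : ℕ} (h : I ≤ K) :
    Match (maskInterp S) (maskInterp S) I I K (idBelow K) where
  biUnique := biUnique_idBelow K
  const c hc := mem_idBelow.2 ⟨hc, rfl⟩
  fluent_iff F x y hxy := by rw [show x = y from funext fun i => (mem_idBelow.1 (hxy i)).2]
  left F x hx i := ⟨x i, mem_idBelow.2 ⟨(lt_of_maskInterp_fluent hx i).trans_le h, rfl⟩⟩
  right F x hx i := ⟨x i, mem_idBelow.2 ⟨(lt_of_maskInterp_fluent hx i).trans_le h, rfl⟩⟩

/-- Fresh witnesses may be taken below an explicit bound. -/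
theorem exists_bounded_match {I K k : ℕ} (h : I ≤ K) (z : Fin k → ℕ) :
    ∃ p, idBelow K ⊆ p ∧ Match (maskInterp S) (maskInterp S) I I K p ∧
      ∃ y : Fin k → ℕ, (∀ i, (z i, y i) ∈ p) ∧ ∀ i, y i < K + k := by
  obtain ⟨p, h1, h2, -, h3, y, hy⟩ :=
    (biUnique_idBelow K).exists_extension_tuple z (Finset.range (K + k))
      (by rw [card_idBelow, Finset.card_range])
  refine ⟨p, h1, (match_idBelow h).mono h1 h2, y, hy, fun i => ?_⟩
  rcases h3 _ (hy i) with h | h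
  · obtain ⟨h5, h6⟩ := mem_idBelow.1 h
    simp only at h5 h6
    omega
  · exact Finset.mem_range.1 h.2

/-! ### Evaluation of coded formulas in coded states -/

/-- Value of a coded object term. -/
def objVal (v : List ℕ) (t : ℕ) : ℕ :=
  if t.unpair.1 = 0 then v.getD t.unpair.2 0 else t.unpair.2

/-- Value of a coded tuple of object terms. -/
def tupleVal (v : List ℕ) (e : ℕ) : ℕ := Encodable.encode ((listOf e).map (objVal v))

/-- Value of a coded action term. -/
def actVal (v w : List ℕ) (c : ℕ) : ℕ :=
  if c.unpair.1 = 0 then w.getD c.unpair.2 0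
  else Nat.pair c.unpair.2.unpair.1 (tupleVal v c.unpair.2.unpair.2)

/-- Arguments of the evaluation: the action arities and the coded state, the coded formula, the
values of the object variables and the coded values of the action variables. -/
abbrev EvalInput : Type := (List ℕ × ℕ) × ℕ × List ℕ × List ℕ

/-- A strict bound for all numbers named by the arguments of the evaluation. -/
def freshBound (b : EvalInput) : ℕ :=
  b.2.1 + Encodable.encode b.2.2.1 + Encodable.encode b.2.2.2 + b.1.2 + 1

/-- A bound for the witnesses of quantifiers. -/
def witnessBound (b : EvalInput) : ℕ := freshBound b + Encodable.encode b.1.1 + 1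

/-- The evaluations on which an evaluation depends directly. -/
def subcalls (b : EvalInput) : List EvalInput :=
  if b.2.1.unpair.1 = 3 then [(b.1, b.2.1.unpair.2, b.2.2)]
  else if b.2.1.unpair.1 = 4 then
    [(b.1, b.2.1.unpair.2.unpair.1, b.2.2), (b.1, b.2.1.unpair.2.unpair.2, b.2.2)]
  else if b.2.1.unpair.1 = 5 then
    (List.range (witnessBound b)).map fun x => (b.1, b.2.1.unpair.2, x :: b.2.2.1, b.2.2.2)
  else if b.2.1.unpair.1 = 6 then
    ((List.range (codeBound (Encodable.encode b.1.1) (witnessBound b))).filter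
      fun k => ValidTuple b.1.1 (witnessBound b) k).map
        fun k => (b.1, b.2.1.unpair.2, b.2.2.1, k :: b.2.2.2)
  else []

/-- The condition for an evaluation to succeed, given the results of those it depends on. -/
def Combine (b : EvalInput) (r : List Bool) : Prop :=
  if b.2.1.unpair.1 = 0 then
    objVal b.2.2.1 b.2.1.unpair.2.unpair.1 = objVal b.2.2.1 b.2.1.unpair.2.unpair.2
  else if b.2.1.unpair.1 = 1 then
    actVal b.2.2.1 b.2.2.2 b.2.1.unpair.2.unpair.1 = actVal b.2.2.1 b.2.2.2 b.2.1.unpair.2.unpair.2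
  else if b.2.1.unpair.1 = 2 then
    HasBit b.1.2 (Nat.pair b.2.1.unpair.2.unpair.1 (tupleVal b.2.2.1 b.2.1.unpair.2.unpair.2))
  else if b.2.1.unpair.1 = 3 then ¬ ∃ x ∈ r, x = true
  else if b.2.1.unpair.1 = 4 then ¬ ∃ x ∈ r, x = false
  else ∃ x ∈ r, x = true

/-- Connectives and quantifiers have nonzero tags, and pairing with a nonzero first component
strictly increases the second. This gives both termination and the measure for course-of-values
recursion. -/
theorem subcalls_lt (b b' : EvalInput) (h : b' ∈ subcalls b) : b'.2.1 < b.2.1 := by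
  have key : 0 < b.2.1.unpair.1 → b.2.1.unpair.2 < b.2.1 := fun h => by
    have := lt_pair_of_pos (b := b.2.1.unpair.2) h
    rwa [Nat.pair_unpair] at this
  have k1 := Nat.unpair_left_le b.2.1.unpair.2
  have k2 := Nat.unpair_right_le b.2.1.unpair.2
  unfold subcalls at h
  split_ifs at h with h3 h4 h5 h6
  · obtain rfl := List.mem_singleton.1 h
    exact key (by omega)
  · rcases List.mem_pair.1 h with rfl | rfl
    · exact k1.trans_lt (key (by omega))
    · exact k2.trans_lt (key (by omega))
  · obtain ⟨x, -, rfl⟩ := List.mem_map.1 h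
    exact key (by omega)
  · obtain ⟨x, -, rfl⟩ := List.mem_map.1 h
    exact key (by omega)
  · simp at h

instance (b : EvalInput) (r : List Bool) : Decidable (Combine b r) := by
  unfold Combine
  infer_instance

/-- Truth of a coded formula in a coded state. -/
def evalCode (b : EvalInput) : Bool :=
  decide (Combine b ((subcalls b).attach.map fun b' => evalCode b'.1))
termination_by b.2.1
decreasing_by exact subcalls_lt _ _ b'.2

theorem evalCode_iff_combine (b : EvalInput) :
    evalCode b = true ↔ Combine b ((subcalls b).map evalCode) := by
  rw [evalCode, decide_eq_true_iff, List.attach_map_val (f := evalCode)]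

section Correctness

variable {n m : ℕ}

theorem objVal_code (t : ObjTerm n) (v : Fin n → ℕ) :
    objVal (List.ofFn v) t.code = t.eval (maskInterp S) v := by
  cases t with
  | var i => simp [objVal, ObjTerm.code, ObjTerm.eval]
  | const c => simp [objVal, ObjTerm.code, ObjTerm.eval]

theorem tupleVal_code {k : ℕ} (ts : Fin k → ObjTerm n) (v : Fin n → ℕ) :
    tupleVal (List.ofFn v) (tupleCode ts) =
      encTuple fun i => (ts i).eval (maskInterp S) v := by
  have : listOf (tupleCode ts) = List.ofFn fun i => (ts i).code := listOf_encode _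
  rw [tupleVal, this, List.map_ofFn, encTuple]
  congr 2
  funext i
  exact objVal_code _ _

theorem actVal_code (t : ActTerm S n m) (v : Fin n → ℕ) (w : Fin m → (maskInterp S).Act) :
    actVal (List.ofFn v) (List.ofFn fun j => actCode (w j)) t.code =
      actCode (t.eval (maskInterp S) v w) := by
  cases t with
  | var i => simp [actVal, ActTerm.code, ActTerm.eval]
  | app A ts => simp [actVal, ActTerm.code, ActTerm.eval, tupleVal_code (S := S), actCode]

theorem idBelow_assignment {K : ℕ} {v : Fin n → ℕ} (h : ∀ i, v i < K) (i : Fin n) :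
    (v i, v i) ∈ idBelow K := mem_idBelow.2 ⟨h i, rfl⟩

theorem relAct_idBelow {K : ℕ} {a : (maskInterp S).Act} (h : ∀ i, a.2 i < K) :
    RelAct (maskInterp S) (maskInterp S) (idBelow K) a a :=
  ⟨a.1, a.2, a.2, rfl, rfl, fun i => mem_idBelow.2 ⟨h i, rfl⟩⟩

theorem lt_actCode (a : (maskInterp S).Act) (i : Fin (S.actionArity a.1)) : a.2 i < actCode a :=
  (lt_encTuple _ i).trans_le (Nat.right_le_pair _ _)

/-- All parameters, constants and active objects lie below `K`, so a matching fixing the numbers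
below `K` moves any witness below `K + 1`. -/
theorem exObj_holds_iff {φ : Formula S (n + 1) m} {I K K' : ℕ} (hI : I ≤ K) {v : Fin n → ℕ}
    (hv : ∀ i, v i < K) {w : Fin m → (maskInterp S).Act} (hw : ∀ j, ∀ i, (w j).2 i < K)
    (hφ : φ.code < K) (hK : K + 1 ≤ K') :
    (Formula.exObj φ).Holds (maskInterp S) I v w ↔
      ∃ x < K', φ.Holds (maskInterp S) I (Fin.cons x v) w := by
  constructor
  · rintro ⟨x, hx⟩
    obtain ⟨p, h1, h2, y, hy, hyK⟩ := exists_bounded_match (S := S) hI fun _ : Fin 1 => x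
    refine ⟨y 0, (hyK 0).trans_le hK, ?_⟩
    exact (h2.holds_iff (actionAxioms_maskInterp S) (actionAxioms_maskInterp S) φ hφ
      (forall_cons_rel (r := fun a b => (a, b) ∈ p) (hy 0)
        fun i => h1 (idBelow_assignment hv i))
      fun j => (relAct_idBelow (hw j)).mono h1).1 hx
  · rintro ⟨x, -, hx⟩
    exact ⟨x, hx⟩

/-- As for objects, with room for as many fresh numbers as the action has arguments. -/
theorem exAct_holds_iff {φ : Formula S n (m + 1)} {I K K' : ℕ} (hI : I ≤ K) {v : Fin n → ℕ}
    (hv : ∀ i, v i < K) {w : Fin m → (maskInterp S).Act} (hw : ∀ j, ∀ i, (w j).2 i < K)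
    (hφ : φ.code < K) (hK : ∀ A : S.ActionType, K + S.actionArity A ≤ K') :
    (Formula.exAct φ).Holds (maskInterp S) I v w ↔
      ∃ a : (maskInterp S).Act, (∀ i, a.2 i < K') ∧
        φ.Holds (maskInterp S) I v (Fin.cons a w) := by
  constructor
  · rintro ⟨a, ha⟩
    obtain ⟨p, h1, h2, y, hy, hyK⟩ := exists_bounded_match (S := S) hI a.2
    refine ⟨⟨a.1, y⟩, fun i => (hyK i).trans_le (hK _), ?_⟩
    exact (h2.holds_iff (actionAxioms_maskInterp S) (actionAxioms_maskInterp S) φ hφ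
      (fun i => h1 (idBelow_assignment hv i))
      (forall_cons_rel (r := RelAct (maskInterp S) (maskInterp S) p) ⟨a.1, a.2, y, rfl, rfl, hy⟩
        fun j => (relAct_idBelow (hw j)).mono h1)).1 ha
  · rintro ⟨a, -, ha⟩
    exact ⟨a, ha⟩

theorem actionArity_lt_encode (A : S.ActionType) :
    S.actionArity A < Encodable.encode S.actionArities :=
  le_encode_of_mem (List.get_mem _ _)

/-- Evaluation of codes computes truth in coded states. -/
theorem evalCode_iff_holds (I : ℕ) (φ : Formula S n m) :
    ∀ (v : Fin n → ℕ) (w : Fin m → (maskInterp S).Act),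
      evalCode ((S.actionArities, I), φ.code, List.ofFn v, List.ofFn fun j => actCode (w j)) = true
        ↔ φ.Holds (maskInterp S) I v w := by
  induction φ with
  | objEq t₁ t₂ =>
    intro v w
    rw [evalCode_iff_combine]
    simp [Combine, Formula.code, objVal_code (S := S), Formula.Holds]
  | actEq t₁ t₂ =>
    intro v w
    rw [evalCode_iff_combine]
    simp [Combine, Formula.code, actVal_code, Formula.Holds, actCode_injective.eq_iff]
  | fluent F ts =>
    intro v w
    rw [evalCode_iff_combine]
    simp [Combine, Formula.code, tupleVal_code (S := S), Formula.Holds]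
  | not φ ih =>
    intro v w
    rw [evalCode_iff_combine]
    simp only [Combine, Formula.code, Nat.unpair_pair, subcalls]
    simp [Formula.Holds]
    rw [← Bool.not_eq_true, ih v w]
  | and φ ψ ih₁ ih₂ =>
    intro v w
    rw [evalCode_iff_combine]
    simp only [Combine, Formula.code, Nat.unpair_pair, subcalls]
    simp [ih₁ v w, ih₂ v w, Formula.Holds]
  | @exObj n m φ ih =>
    intro v w
    rw [evalCode_iff_combine]
    -- The codes of the assignments bound all objects in them, so `freshBound` is a legitimate
    -- threshold `K`.
    have hv : ∀ i, v i < Encodable.encode (List.ofFn v) := lt_encTuple v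
    have hw : ∀ j, ∀ i, (w j).2 i < Encodable.encode (List.ofFn fun j => actCode (w j)) :=
      fun j i => (lt_actCode _ i).trans (lt_encTuple (fun j => actCode (w j)) j)
    have hc := Nat.right_le_pair 5 φ.code
    rw [exObj_holds_iff (K := freshBound ((S.actionArities, I), (Formula.exObj φ).code,
      List.ofFn v, List.ofFn fun j => actCode (w j)))
      (K' := witnessBound ((S.actionArities, I), (Formula.exObj φ).code,
      List.ofFn v, List.ofFn fun j => actCode (w j)))
      (by simp only [freshBound]; omega) (fun i => by have := hv i; simp only [freshBound]; omega)
      (fun j i => by have := hw j i; simp only [freshBound]; omega)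
      (by simp only [freshBound, Formula.code]; omega) (by simp only [witnessBound]; omega)]
    simp only [Combine, Formula.code, Nat.unpair_pair, subcalls]
    simp only [← ih]
    simp
  | @exAct n m φ ih =>
    intro v w
    rw [evalCode_iff_combine]
    have hv : ∀ i, v i < Encodable.encode (List.ofFn v) := lt_encTuple v
    have hw : ∀ j, ∀ i, (w j).2 i < Encodable.encode (List.ofFn fun j => actCode (w j)) :=
      fun j i => (lt_actCode _ i).trans (lt_encTuple (fun j => actCode (w j)) j)
    have hc := Nat.right_le_pair 6 φ.code
    rw [exAct_holds_iff (K := freshBound ((S.actionArities, I), (Formula.exAct φ).code,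
      List.ofFn v, List.ofFn fun j => actCode (w j)))
      (K' := witnessBound ((S.actionArities, I), (Formula.exAct φ).code,
      List.ofFn v, List.ofFn fun j => actCode (w j)))
      (by simp only [freshBound]; omega) (fun i => by have := hv i; simp only [freshBound]; omega)
      (fun j i => by have := hw j i; simp only [freshBound]; omega)
      (by simp only [freshBound, Formula.code]; omega)
      (fun A => by have := actionArity_lt_encode A; simp only [witnessBound]; omega)]
    simp only [Combine, Formula.code, Nat.unpair_pair, subcalls]
    simp only [← ih, List.ofFn_succ, Fin.cons_zero, Fin.cons_succ]
    simp only [OfNat.ofNat_ne_zero, OfNat.ofNat_ne_one, if_false, if_true, Nat.reduceEqDiff,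
      List.mem_map, List.mem_filter, List.mem_range]
    constructor
    · rintro ⟨_, ⟨_, ⟨k, ⟨hk, hv⟩, rfl⟩, rfl⟩, h⟩
      -- The filter in `subcalls` admits only codes of genuine ground actions.
      obtain ⟨A, z, rfl, hz⟩ := validTuple_iff.1 (of_decide_eq_true hv)
      exact ⟨⟨A, z⟩, hz, h⟩
    · rintro ⟨a, ha, h⟩
      have hval := validTuple_iff.2 ⟨a.1, a.2, rfl, ha⟩
      refine ⟨_, ⟨_, ⟨actCode a, ⟨hval.lt_codeBound (length_le_encode _)
        fun r hr => (le_encode_of_mem hr).le, decide_eq_true hval⟩, rfl⟩, rfl⟩, h⟩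

end Correctness

/-! ### Primitive recursiveness of the evaluation -/

section PrimrecPred

variable {α : Type*} [Primcodable α]

theorem primrecPred_imp {p q : α → Prop} (hp : PrimrecPred p) (hq : PrimrecPred q) :
    PrimrecPred fun a => p a → q a :=
  (hp.not.or hq).of_eq fun _ => by tauto

theorem primrecPred_iff {p q : α → Prop} (hp : PrimrecPred p) (hq : PrimrecPred q) :
    PrimrecPred fun a => p a ↔ q a :=
  ((primrecPred_imp hp hq).and (primrecPred_imp hq hp)).of_eq fun _ => by tauto

open Classical in
theorem primrecPred_ite {c p q : α → Prop} [DecidablePred c] (hc : PrimrecPred c)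
    (hp : PrimrecPred p) (hq : PrimrecPred q) : PrimrecPred fun a => if c a then p a else q a :=
  ((hc.and hp).or (hc.not.and hq)).of_eq fun a => by by_cases h : c a <;> simp [h]

theorem primrecPred_exists_lt {g : α → ℕ} {R : α → ℕ → Prop} (hg : Primrec g)
    (hR : PrimrecPred fun p : α × ℕ => R p.1 p.2) : PrimrecPred fun a => ∃ x < g a, R a x :=
  ((PrimrecRel.exists_mem_list (R := fun x a => R a x) (PrimrecRel.swap (r := R) hR)).comp
    (Primrec.list_range.comp hg) Primrec.id).of_eq fun a => by simp

theorem primrecPred_forall_lt {g : α → ℕ} {R : α → ℕ → Prop} (hg : Primrec g)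
    (hR : PrimrecPred fun p : α × ℕ => R p.1 p.2) : PrimrecPred fun a => ∀ x < g a, R a x :=
  ((PrimrecRel.forall_mem_list (R := fun x a => R a x) (PrimrecRel.swap (r := R) hR)).comp
    (Primrec.list_range.comp hg) Primrec.id).of_eq fun a => by simp

theorem primrecPred_forall_mem {β : Type*} [Primcodable β] {g : α → List β} {R : α → β → Prop}
    (hg : Primrec g) (hR : PrimrecPred fun p : α × β => R p.1 p.2) :
    PrimrecPred fun a => ∀ x ∈ g a, R a x :=
  (PrimrecRel.forall_mem_list (PrimrecRel.swap (r := R) hR)).comp hg Primrec.id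

theorem primrecPred_exists_eq {g : α → List Bool} (hg : Primrec g) (c : Bool) :
    PrimrecPred fun a => ∃ x ∈ g a, x = c :=
  (PrimrecRel.exists_mem_list (R := fun x (_ : α) => x = c)
    (Primrec.eq.comp Primrec.fst (Primrec.const c))).comp hg Primrec.id

theorem primrec_filter {β : Type*} [Primcodable β] {g : α → List β} {R : α → β → Prop}
    [∀ a, DecidablePred (R a)] (hg : Primrec g) (hR : PrimrecPred fun p : α × β => R p.1 p.2) :
    Primrec fun a => (g a).filter fun x => R a x :=
  ((PrimrecRel.listFilter (R := fun x a => R a x) (PrimrecRel.swap (r := R) hR)).comp hg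
    Primrec.id).of_eq fun _ => rfl

variable {f g : α → ℕ} {v w : α → List ℕ}

theorem primrec_left (hf : Primrec f) : Primrec fun a => (f a).unpair.1 :=
  Primrec.fst.comp (Primrec.unpair.comp hf)

theorem primrec_right (hf : Primrec f) : Primrec fun a => (f a).unpair.2 :=
  Primrec.snd.comp (Primrec.unpair.comp hf)

theorem primrec_listOf (hf : Primrec f) : Primrec fun a => listOf (f a) :=
  (Primrec.option_getD.comp ((Primrec.decode (α := List ℕ)).comp hf) (Primrec.const [])).of_eq
    fun a => by simp [Denumerable.decode_eq_ofNat]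

theorem primrecPred_eq_const (hf : Primrec f) (c : ℕ) : PrimrecPred fun a => f a = c :=
  Primrec.eq.comp hf (Primrec.const c)

theorem primrec_two_pow (hf : Primrec f) : Primrec fun a => 2 ^ f a :=
  (Primrec₂.unpaired'.1 Nat.Primrec.pow).comp (Primrec.const 2) hf

theorem primrecPred_hasBit (hf : Primrec f) (hg : Primrec g) :
    PrimrecPred fun a => HasBit (f a) (g a) :=
  primrecPred_eq_const
    (Primrec.nat_mod.comp (Primrec.nat_div.comp hf (primrec_two_pow hg)) (Primrec.const 2)) 1

theorem primrecPred_validTuple (hv : Primrec v) (hf : Primrec f) (hg : Primrec g) :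
    PrimrecPred fun a => ValidTuple (v a) (f a) (g a) :=
  (Primrec.nat_lt.comp (primrec_left hg) (Primrec.list_length.comp hv)).and
    ((Primrec.eq.comp (Primrec.list_length.comp (primrec_listOf (primrec_right hg)))
      ((Primrec.list_getD 0).comp hv (primrec_left hg))).and
    (primrecPred_forall_mem (primrec_listOf (primrec_right hg))
      (Primrec.nat_lt.comp Primrec.snd (hf.comp Primrec.fst))))

theorem primrec_codeBound (hf : Primrec f) (hg : Primrec g) :
    Primrec fun a => codeBound (f a) (g a) :=
  Primrec.succ.comp (Primrec₂.natPair.comp hf (Primrec.encode.comp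
    (Primrec.list_map (Primrec.list_range.comp hf) (hg.comp Primrec.fst).to₂)))

theorem primrec_objVal (hv : Primrec v) (hf : Primrec f) :
    Primrec fun a => objVal (v a) (f a) :=
  Primrec.ite (primrecPred_eq_const (primrec_left hf) 0)
    ((Primrec.list_getD 0).comp hv (primrec_right hf)) (primrec_right hf)

theorem primrec_tupleVal (hv : Primrec v) (hf : Primrec f) :
    Primrec fun a => tupleVal (v a) (f a) :=
  Primrec.encode.comp (Primrec.list_map (primrec_listOf hf)
    (primrec_objVal (hv.comp Primrec.fst) Primrec.snd).to₂)

theorem primrec_actVal (hv : Primrec v) (hw : Primrec w) (hf : Primrec f) :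
    Primrec fun a => actVal (v a) (w a) (f a) :=
  Primrec.ite (primrecPred_eq_const (primrec_left hf) 0)
    ((Primrec.list_getD 0).comp hw (primrec_right hf))
    (Primrec₂.natPair.comp (primrec_left (primrec_right hf))
      (primrec_tupleVal hv (primrec_right (primrec_right hf))))

end PrimrecPred

section EvalInput

theorem primrec_input_code : Primrec fun b : EvalInput => b.2.1 :=
  Primrec.fst.comp Primrec.snd

theorem primrec_input_objs : Primrec fun b : EvalInput => b.2.2.1 :=
  Primrec.fst.comp (Primrec.snd.comp Primrec.snd)

theorem primrec_input_acts : Primrec fun b : EvalInput => b.2.2.2 :=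
  Primrec.snd.comp (Primrec.snd.comp Primrec.snd)

theorem primrec_input_arities : Primrec fun b : EvalInput => b.1.1 :=
  Primrec.fst.comp Primrec.fst

theorem primrec_input_state : Primrec fun b : EvalInput => b.1.2 :=
  Primrec.snd.comp Primrec.fst

theorem primrec_witnessBound : Primrec witnessBound := by
  have h : Primrec freshBound :=
    Primrec.succ.comp (Primrec.nat_add.comp (Primrec.nat_add.comp (Primrec.nat_add.comp
      primrec_input_code (Primrec.encode.comp primrec_input_objs))
      (Primrec.encode.comp primrec_input_acts)) primrec_input_state)
  exact Primrec.succ.comp (Primrec.nat_add.comp h (Primrec.encode.comp primrec_input_arities))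

theorem primrec_subcalls : Primrec subcalls := by
  have tag := primrec_left primrec_input_code
  have arg := primrec_right primrec_input_code
  have single : ∀ {f : EvalInput → EvalInput}, Primrec f → Primrec fun b => [f b] := fun hf =>
    Primrec.list_cons.comp hf (Primrec.const [])
  refine Primrec.ite (primrecPred_eq_const tag 3)
    (single (Primrec.pair Primrec.fst (Primrec.pair arg (Primrec.snd.comp Primrec.snd)))) ?_
  refine Primrec.ite (primrecPred_eq_const tag 4) (Primrec.list_cons.comp
    (Primrec.pair Primrec.fst (Primrec.pair (primrec_left arg) (Primrec.snd.comp Primrec.snd)))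
    (single (Primrec.pair Primrec.fst
      (Primrec.pair (primrec_right arg) (Primrec.snd.comp Primrec.snd))))) ?_
  refine Primrec.ite (primrecPred_eq_const tag 5) (Primrec.list_map
    (Primrec.list_range.comp primrec_witnessBound) ?_) ?_
  · exact (Primrec.pair (Primrec.fst.comp Primrec.fst) (Primrec.pair (arg.comp Primrec.fst)
      (Primrec.pair (Primrec.list_cons.comp Primrec.snd (primrec_input_objs.comp Primrec.fst))
        (primrec_input_acts.comp Primrec.fst)))).to₂
  refine Primrec.ite (primrecPred_eq_const tag 6) (Primrec.list_map (primrec_filter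
    (R := fun b k => ValidTuple b.1.1 (witnessBound b) k) (Primrec.list_range.comp
    (primrec_codeBound (Primrec.encode.comp primrec_input_arities) primrec_witnessBound))
    (primrecPred_validTuple (primrec_input_arities.comp Primrec.fst)
      (primrec_witnessBound.comp Primrec.fst) Primrec.snd)) ?_) (Primrec.const [])
  exact (Primrec.pair (Primrec.fst.comp Primrec.fst) (Primrec.pair (arg.comp Primrec.fst)
      (Primrec.pair (primrec_input_objs.comp Primrec.fst)
        (Primrec.list_cons.comp Primrec.snd (primrec_input_acts.comp Primrec.fst))))).to₂

theorem primrecPred_combine : PrimrecPred fun p : EvalInput × List Bool => Combine p.1 p.2 := by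
  have code : Primrec fun p : EvalInput × List Bool => p.1.2.1 :=
    primrec_input_code.comp Primrec.fst
  have objs : Primrec fun p : EvalInput × List Bool => p.1.2.2.1 :=
    primrec_input_objs.comp Primrec.fst
  have acts : Primrec fun p : EvalInput × List Bool => p.1.2.2.2 :=
    primrec_input_acts.comp Primrec.fst
  have state : Primrec fun p : EvalInput × List Bool => p.1.1.2 :=
    primrec_input_state.comp Primrec.fst
  have tag := primrec_left code
  have arg₁ := primrec_left (primrec_right code)
  have arg₂ := primrec_right (primrec_right code)
  exact primrecPred_ite (primrecPred_eq_const tag 0)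
      (Primrec.eq.comp (primrec_objVal objs arg₁) (primrec_objVal objs arg₂))
    (primrecPred_ite (primrecPred_eq_const tag 1)
      (Primrec.eq.comp (primrec_actVal objs acts arg₁) (primrec_actVal objs acts arg₂))
    (primrecPred_ite (primrecPred_eq_const tag 2)
      (primrecPred_hasBit state (Primrec₂.natPair.comp arg₁ (primrec_tupleVal objs arg₂)))
    (primrecPred_ite (primrecPred_eq_const tag 3) (primrecPred_exists_eq Primrec.snd true).not
    (primrecPred_ite (primrecPred_eq_const tag 4) (primrecPred_exists_eq Primrec.snd false).not
      (primrecPred_exists_eq Primrec.snd true)))))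

/-- Course-of-values recursion on the formula code: the list of smaller evaluations and the
combination of their results are both primitive recursive. -/
theorem primrec_evalCode : Primrec evalCode := by
  refine Primrec.nat_omega_rec' evalCode (m := fun b => b.2.1) (l := subcalls)
    (g := fun b r => some (decide (Combine b r))) primrec_input_code primrec_subcalls
    (Primrec.option_some.comp primrecPred_combine.decide).to₂ subcalls_lt fun b => ?_
  rw [Option.some_inj, Bool.eq_iff_iff, decide_eq_true_iff, evalCode_iff_combine]

end EvalInput

/-! ### The decision procedure -/

section Procedure

/-- The bound `b` in the input. -/
def inputBound (x : ℕ) : ℕ := x.unpair.2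

/-- The arities of the fluents in the input. -/
def inputFluents (x : ℕ) : List ℕ := listOf x.unpair.1.unpair.1.unpair.1

/-- The arities of the actions in the input. -/
def inputActions (x : ℕ) : List ℕ := listOf x.unpair.1.unpair.1.unpair.2

/-- The codes of the sentences describing the initial situation. -/
def inputInitial (x : ℕ) : List ℕ := listOf x.unpair.1.unpair.2.unpair.1

/-- The codes of the right-hand sides of the precondition axioms. -/
def inputPrecond (x : ℕ) : List ℕ := listOf x.unpair.1.unpair.2.unpair.2.unpair.1

/-- The codes of the right-hand sides of the successor state axioms. -/
def inputSuccState (x : ℕ) : List ℕ := listOf x.unpair.1.unpair.2.unpair.2.unpair.2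

/-- The number of objects that suffice to represent all bounded situations and their actions. -/
def objBound (x : ℕ) : ℕ := x * (x * x) + (4 * x + 10)

/-- A bound for the codes of facts and ground actions over these objects. -/
def factBound (x : ℕ) : ℕ := codeBound x (objBound x)

/-- The coded state consists of facts over the first objects. -/
def WellFormed (x I : ℕ) : Prop :=
  ∀ k < factBound x, HasBit I k → ValidTuple (inputFluents x) (objBound x) k

/-- Each fluent has fewer tuples than allowed in the coded state. -/
def BoundedCode (x I : ℕ) : Prop :=
  ∀ F < (inputFluents x).length,
    ((List.range (factBound x)).filter fun k => HasBit I k ∧ k.unpair.1 = F).length < inputBound x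

/-- The coded state satisfies the description of the initial situation. -/
def InitialCode (x I : ℕ) : Prop :=
  ∀ c ∈ inputInitial x, evalCode ((inputActions x, I), c, [], []) = true

/-- The coded action is possible in the coded state. -/
def PossCode (x I k : ℕ) : Prop :=
  ValidTuple (inputActions x) (objBound x) k ∧
    evalCode ((inputActions x, I), (inputPrecond x).getD k.unpair.1 0, listOf k.unpair.2, []) = true

/-- The coded action leads from the coded state `I` to the coded state `J`. -/
def StepCode (x I k J : ℕ) : Prop :=
  ∀ q < factBound x, HasBit J q ↔ ValidTuple (inputFluents x) (objBound x) q ∧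
    evalCode ((inputActions x, I), (inputSuccState x).getD q.unpair.1 0, listOf q.unpair.2, [k])
      = true

/-- Some set of bounded states contains the initial states and is closed under actions. -/
def Invariant (x : ℕ) : Prop :=
  ∃ R < 2 ^ 2 ^ factBound x, ∀ I < 2 ^ factBound x,
    (WellFormed x I ∧ BoundedCode x I ∧ InitialCode x I → HasBit R I) ∧
    (HasBit R I → BoundedCode x I ∧
      ∀ k < factBound x, PossCode x I k →
        ∃ J < 2 ^ factBound x, HasBit R J ∧ StepCode x I k J)

/-! ### Primitive recursiveness of the decision procedure. -/

variable {α : Type*} [Primcodable α] {x I J k : α → ℕ}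

theorem primrec_inputFluents (hx : Primrec x) : Primrec fun a => inputFluents (x a) :=
  primrec_listOf (primrec_left (primrec_left (primrec_left hx)))

theorem primrec_inputActions (hx : Primrec x) : Primrec fun a => inputActions (x a) :=
  primrec_listOf (primrec_right (primrec_left (primrec_left hx)))

theorem primrec_inputInitial (hx : Primrec x) : Primrec fun a => inputInitial (x a) :=
  primrec_listOf (primrec_left (primrec_right (primrec_left hx)))

theorem primrec_inputPrecond (hx : Primrec x) : Primrec fun a => inputPrecond (x a) :=
  primrec_listOf (primrec_left (primrec_right (primrec_right (primrec_left hx))))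

theorem primrec_inputSuccState (hx : Primrec x) : Primrec fun a => inputSuccState (x a) :=
  primrec_listOf (primrec_right (primrec_right (primrec_right (primrec_left hx))))

theorem primrec_objBound (hx : Primrec x) : Primrec fun a => objBound (x a) :=
  Primrec.nat_add.comp (Primrec.nat_mul.comp hx (Primrec.nat_mul.comp hx hx))
    (Primrec.nat_add.comp (Primrec.nat_mul.comp (Primrec.const 4) hx) (Primrec.const 10))

theorem primrec_factBound (hx : Primrec x) : Primrec fun a => factBound (x a) :=
  primrec_codeBound hx (primrec_objBound hx)

theorem primrecPred_evalCode {l : α → List ℕ} {c : α → ℕ} {v w : α → List ℕ} (hl : Primrec l)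
    (hI : Primrec I) (hc : Primrec c) (hv : Primrec v) (hw : Primrec w) :
    PrimrecPred fun a => evalCode ((l a, I a), c a, v a, w a) = true :=
  Primrec.eq.comp (primrec_evalCode.comp (Primrec.pair (Primrec.pair hl hI)
    (Primrec.pair hc (Primrec.pair hv hw)))) (Primrec.const true)

theorem primrecPred_wellFormed (hx : Primrec x) (hI : Primrec I) :
    PrimrecPred fun a => WellFormed (x a) (I a) :=
  primrecPred_forall_lt (primrec_factBound hx) (primrecPred_imp
    (primrecPred_hasBit (hI.comp Primrec.fst) Primrec.snd)
    (primrecPred_validTuple (primrec_inputFluents (hx.comp Primrec.fst))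
      (primrec_objBound (hx.comp Primrec.fst)) Primrec.snd))

theorem primrecPred_boundedCode (hx : Primrec x) (hI : Primrec I) :
    PrimrecPred fun a => BoundedCode (x a) (I a) :=
  primrecPred_forall_lt (Primrec.list_length.comp (primrec_inputFluents hx))
    (Primrec.nat_lt.comp (Primrec.list_length.comp (primrec_filter
      (R := fun (p : α × ℕ) k => HasBit (I p.1) k ∧ k.unpair.1 = p.2)
      (Primrec.list_range.comp (primrec_factBound (hx.comp Primrec.fst)))
      ((primrecPred_hasBit (hI.comp (Primrec.fst.comp Primrec.fst)) Primrec.snd).and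
        (Primrec.eq.comp (primrec_left Primrec.snd) (Primrec.snd.comp Primrec.fst)))))
      (primrec_right (hx.comp Primrec.fst)))

theorem primrecPred_initialCode (hx : Primrec x) (hI : Primrec I) :
    PrimrecPred fun a => InitialCode (x a) (I a) :=
  primrecPred_forall_mem (primrec_inputInitial hx)
    (primrecPred_evalCode (primrec_inputActions (hx.comp Primrec.fst)) (hI.comp Primrec.fst)
      Primrec.snd (Primrec.const []) (Primrec.const []))

theorem primrecPred_possCode (hx : Primrec x) (hI : Primrec I) (hk : Primrec k) :
    PrimrecPred fun a => PossCode (x a) (I a) (k a) :=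
  (primrecPred_validTuple (primrec_inputActions hx) (primrec_objBound hx) hk).and
    (primrecPred_evalCode (primrec_inputActions hx) hI
      ((Primrec.list_getD 0).comp (primrec_inputPrecond hx) (primrec_left hk))
      (primrec_listOf (primrec_right hk)) (Primrec.const []))

theorem primrecPred_stepCode (hx : Primrec x) (hI : Primrec I) (hk : Primrec k)
    (hJ : Primrec J) : PrimrecPred fun a => StepCode (x a) (I a) (k a) (J a) := by
  have hx' := hx.comp (Primrec.fst (α := α) (β := ℕ))
  exact primrecPred_forall_lt (primrec_factBound hx) (primrecPred_iff
    (primrecPred_hasBit (hJ.comp Primrec.fst) Primrec.snd)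
    ((primrecPred_validTuple (primrec_inputFluents hx') (primrec_objBound hx') Primrec.snd).and
    (primrecPred_evalCode (primrec_inputActions hx') (hI.comp Primrec.fst)
      ((Primrec.list_getD 0).comp (primrec_inputSuccState hx') (primrec_left Primrec.snd))
      (primrec_listOf (primrec_right Primrec.snd))
      (Primrec.list_cons.comp (hk.comp Primrec.fst) (Primrec.const [])))))

theorem primrecPred_invariant : PrimrecPred Invariant := by
  -- Subscripts count the quantifiers already entered: `R` and `I` for 2, then `k`, then `J`.
  have hx₂ := Primrec.fst.comp (Primrec.fst (α := ℕ × ℕ) (β := ℕ))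
  have hx₃ := hx₂.comp (Primrec.fst (β := ℕ))
  have hx₄ := hx₃.comp (Primrec.fst (β := ℕ))
  have hI₂ := Primrec.snd (α := ℕ × ℕ) (β := ℕ)
  have hI₃ := hI₂.comp (Primrec.fst (β := ℕ))
  have hI₄ := hI₃.comp (Primrec.fst (β := ℕ))
  have hR₂ := Primrec.snd.comp (Primrec.fst (α := ℕ × ℕ) (β := ℕ))
  have hR₄ := (hR₂.comp (Primrec.fst (β := ℕ))).comp (Primrec.fst (β := ℕ))
  have hk₄ := (Primrec.snd (α := (ℕ × ℕ) × ℕ) (β := ℕ)).comp (Primrec.fst (β := ℕ))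
  exact primrecPred_exists_lt (primrec_two_pow (primrec_two_pow (primrec_factBound Primrec.id)))
    (primrecPred_forall_lt (primrec_two_pow (primrec_factBound Primrec.fst))
      ((primrecPred_imp ((primrecPred_wellFormed hx₂ hI₂).and
        ((primrecPred_boundedCode hx₂ hI₂).and (primrecPred_initialCode hx₂ hI₂)))
        (primrecPred_hasBit hR₂ hI₂)).and
      (primrecPred_imp (primrecPred_hasBit hR₂ hI₂) ((primrecPred_boundedCode hx₂ hI₂).and
        (primrecPred_forall_lt (primrec_factBound hx₂) (primrecPred_imp
          (primrecPred_possCode hx₃ hI₃ Primrec.snd)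
          (primrecPred_exists_lt (primrec_two_pow (primrec_factBound hx₃))
            ((primrecPred_hasBit hR₄ Primrec.snd).and
              (primrecPred_stepCode hx₄ hI₄ hk₄ Primrec.snd)))))))))

end Procedure

/-! ### Correctness of the decision procedure -/

section Correctness

variable (D : BAT S) (b : ℕ)

/-- The input that codes the theory and the bound. -/
abbrev BAT.input : ℕ := Nat.pair D.code b

/-! ### Decoding the input and bounding its components. -/

@[simp] theorem inputBound_input : inputBound (D.input b) = b := by
  simp [inputBound]

@[simp] theorem inputFluents_input : inputFluents (D.input b) = S.fluentArities := by
  simp only [inputFluents, BAT.code, Signature.code, Nat.unpair_pair]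
  exact listOf_encode _

@[simp] theorem inputActions_input : inputActions (D.input b) = S.actionArities := by
  simp only [inputActions, BAT.code, Signature.code, Nat.unpair_pair]
  exact listOf_encode _

@[simp] theorem inputInitial_input :
    inputInitial (D.input b) = D.initial.map Formula.code := by
  simp only [inputInitial, BAT.code, Nat.unpair_pair]
  exact listOf_encode _

@[simp] theorem inputPrecond_input :
    inputPrecond (D.input b) = List.ofFn fun A => (D.precond A).code := by
  simp only [inputPrecond, BAT.code, Nat.unpair_pair]
  exact listOf_encode _

@[simp] theorem inputSuccState_input :
    inputSuccState (D.input b) = List.ofFn fun F => (D.succState F).code := by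
  simp only [inputSuccState, BAT.code, Nat.unpair_pair]
  exact listOf_encode _

theorem encode_listOf (k : ℕ) : Encodable.encode (listOf k) = k :=
  Denumerable.encode_ofNat k

/-- This makes the input a common bound for arities, numbers of symbols and formula codes, so that
`D.input b + 1` serves as the constant threshold of all matchings. -/
theorem encode_inputs_le (x : ℕ) :
    Encodable.encode (inputFluents x) ≤ x ∧ Encodable.encode (inputActions x) ≤ x ∧
      Encodable.encode (inputInitial x) ≤ x ∧ Encodable.encode (inputPrecond x) ≤ x ∧
      Encodable.encode (inputSuccState x) ≤ x := by
  have l := fun n => Nat.unpair_left_le n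
  have r := fun n => Nat.unpair_right_le n
  simp only [inputFluents, inputActions, inputInitial, inputPrecond, inputSuccState, encode_listOf]
  exact ⟨((l _).trans (l _)).trans (l _), ((r _).trans (l _)).trans (l _),
    ((l _).trans (r _)).trans (l _), (((l _).trans (r _)).trans (r _)).trans (l _),
    (((r _).trans (r _)).trans (r _)).trans (l _)⟩

theorem length_fluentArities_le : S.fluentArities.length ≤ D.input b := by
  have := (encode_inputs_le (D.input b)).1
  rw [inputFluents_input] at this
  exact (length_le_encode _).trans this

theorem le_input_of_mem_fluentArities {r : ℕ} (hr : r ∈ S.fluentArities) : r ≤ D.input b := by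
  have := (encode_inputs_le (D.input b)).1
  rw [inputFluents_input] at this
  exact (le_encode_of_mem hr).le.trans this

theorem fluentArity_le_input (F : S.Fluent) : S.fluentArity F ≤ D.input b :=
  le_input_of_mem_fluentArities D b (List.get_mem _ _)

theorem length_actionArities_le : S.actionArities.length ≤ D.input b := by
  have := (encode_inputs_le (D.input b)).2.1
  rw [inputActions_input] at this
  exact (length_le_encode _).trans this

theorem le_input_of_mem_actionArities {r : ℕ} (hr : r ∈ S.actionArities) : r ≤ D.input b := by
  have := (encode_inputs_le (D.input b)).2.1
  rw [inputActions_input] at this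
  exact (le_encode_of_mem hr).le.trans this

theorem actionArity_le_input (A : S.ActionType) : S.actionArity A ≤ D.input b :=
  le_input_of_mem_actionArities D b (List.get_mem _ _)

theorem le_input : b ≤ D.input b := Nat.right_le_pair _ _

theorem initial_code_lt {φ : Formula S 0 0} (h : φ ∈ D.initial) : φ.code < D.input b + 1 := by
  have := (encode_inputs_le (D.input b)).2.2.1
  rw [inputInitial_input] at this
  exact ((le_encode_of_mem (List.mem_map_of_mem h)).trans_le this).trans (Nat.lt_succ_self _)

theorem precond_code_lt (A : S.ActionType) : (D.precond A).code < D.input b + 1 := by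
  have := (encode_inputs_le (D.input b)).2.2.2.1
  rw [inputPrecond_input] at this
  exact ((le_encode_of_mem (List.mem_ofFn.2 ⟨A, rfl⟩)).trans_le this).trans (Nat.lt_succ_self _)

theorem succState_code_lt (F : S.Fluent) : (D.succState F).code < D.input b + 1 := by
  have := (encode_inputs_le (D.input b)).2.2.2.2
  rw [inputSuccState_input] at this
  exact ((le_encode_of_mem (List.mem_ofFn.2 ⟨F, rfl⟩)).trans_le this).trans (Nat.lt_succ_self _)

theorem validTuple_pair_iff {ar : List ℕ} {K : ℕ} (i : Fin ar.length) (z : Fin (ar.get i) → ℕ) :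
    ValidTuple ar K (Nat.pair i (encTuple z)) ↔ ∀ j, z j < K := by
  constructor
  · rintro ⟨-, -, h⟩ j
    rw [Nat.unpair_pair, listOf_encTuple] at h
    exact h _ (List.mem_ofFn.2 ⟨j, rfl⟩)
  · exact fun h => validTuple_iff.2 ⟨i, z, rfl, h⟩

theorem fact_lt {F : S.Fluent} {y : Fin (S.fluentArity F) → ℕ}
    (h : ∀ i, y i < objBound (D.input b)) :
    Nat.pair F (encTuple y) < factBound (D.input b) :=
  ((validTuple_pair_iff F y).2 h).lt_codeBound (length_fluentArities_le D b)
    fun _ hr => le_input_of_mem_fluentArities D b hr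

theorem actCode_lt {a : (maskInterp S).Act} (h : ∀ i, a.2 i < objBound (D.input b)) :
    actCode a < factBound (D.input b) :=
  ((validTuple_pair_iff a.1 a.2).2 h).lt_codeBound (length_actionArities_le D b)
    fun _ hr => le_input_of_mem_actionArities D b hr

/-! ### Meaning of the coded predicates. -/

variable {D b}

/-- The size restriction on `I` ensures that the count over positions below `factBound` misses no
fact. -/
theorem bounded_of_boundedCode {I : ℕ} (hI : I < 2 ^ factBound (D.input b))
    (h : BoundedCode (D.input b) I) : (maskInterp S).Bounded b I := by
  rintro F ⟨x, h1, h2⟩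
  have h3 := h F (by rw [inputFluents_input]; exact F.2)
  rw [inputBound_input, ← List.toFinset_card_of_nodup (List.nodup_range.filter _)] at h3
  refine absurd h3 (not_lt.2 ?_)
  have := Finset.card_le_card_of_injOn (s := (Finset.univ : Finset (Fin b)))
    (t := ((List.range (factBound (D.input b))).filter fun k =>
      HasBit I k ∧ k.unpair.1 = F).toFinset) (fun k => Nat.pair F (encTuple (x k)))
    (fun k _ => by
      simp only [List.coe_toFinset, List.mem_filter, List.mem_range, Set.mem_ofPred_eq,
        decide_eq_true_iff]
      exact ⟨(h1 k).lt_of_lt_two_pow hI, h1 k, by simp⟩)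
    (fun k _ l _ hkl => by
      by_contra hne
      exact h2 k l hne (encTuple_injective (Nat.pair_eq_pair.1 hkl).2))
  simpa using this

/-- Well-formedness ensures that each counted position decodes to an actual tuple of the fluent. -/
theorem boundedCode_of_bounded {I : ℕ} (hw : WellFormed (D.input b) I)
    (h : (maskInterp S).Bounded b I) : BoundedCode (D.input b) I := by
  intro F hF
  rw [inputBound_input]
  rw [inputFluents_input] at hF
  by_contra! hle
  set l := (List.range (factBound (D.input b))).filter fun k => HasBit I k ∧ k.unpair.1 = F with hl
  have hmem : ∀ k ∈ l, ∃ z : Fin (S.fluentArity ⟨F, hF⟩) → ℕ,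
      k = Nat.pair F (encTuple z) ∧ HasBit I k := by
    intro k hk
    simp only [hl, List.mem_filter, List.mem_range, decide_eq_true_iff] at hk
    obtain ⟨hk, hb, hkF⟩ := hk
    have hv := hw k hk hb
    rw [inputFluents_input] at hv
    obtain ⟨i, z, rfl, -⟩ := validTuple_iff.1 hv
    rw [Nat.unpair_pair] at hkF
    obtain rfl : i = ⟨F, hF⟩ := Fin.ext hkF
    exact ⟨z, rfl, hb⟩
  have hnd : l.Nodup := List.nodup_range.filter _
  choose z hz hz' using fun k : Fin b =>
    hmem (l.get (Fin.castLE hle k)) (List.get_mem _ _)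
  refine h ⟨F, hF⟩ ⟨z, fun k => ?_, fun k k' hne he => hne ?_⟩
  · have := hz' k
    rw [hz k] at this
    exact this
  · have : l.get (Fin.castLE hle k) = l.get (Fin.castLE hle k') := by
      rw [hz k, hz k', he]
    simpa using List.nodup_iff_injective_get.1 hnd this

theorem initialCode_iff {I : ℕ} : InitialCode (D.input b) I ↔
    ∀ φ ∈ D.initial, φ.Holds (maskInterp S) I Fin.elim0 Fin.elim0 := by
  simp only [InitialCode, inputInitial_input, inputActions_input, List.forall_mem_map]
  refine forall₂_congr fun φ _ => ?_
  rw [← evalCode_iff_holds]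
  simp

theorem possCode_iff {I : ℕ} {a : (maskInterp S).Act} : PossCode (D.input b) I (actCode a) ↔
    (∀ i, a.2 i < objBound (D.input b)) ∧
      (D.precond a.1).Holds (maskInterp S) I a.2 Fin.elim0 := by
  rw [PossCode, inputActions_input, inputPrecond_input, ← evalCode_iff_holds, actCode,
    validTuple_pair_iff]
  simp

theorem eval_succState_iff {I : ℕ} {a : (maskInterp S).Act} {F : S.Fluent}
    {y : Fin (S.fluentArity F) → ℕ} :
    (ValidTuple (inputFluents (D.input b)) (objBound (D.input b)) (Nat.pair F (encTuple y)) ∧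
      evalCode ((inputActions (D.input b), I),
        (inputSuccState (D.input b)).getD (Nat.pair F (encTuple y)).unpair.1 0,
        listOf (Nat.pair F (encTuple y)).unpair.2, [actCode a]) = true) ↔
      (∀ i, y i < objBound (D.input b)) ∧
        (D.succState F).Holds (maskInterp S) I y fun _ => a := by
  rw [inputFluents_input, inputActions_input, inputSuccState_input, ← evalCode_iff_holds,
    validTuple_pair_iff]
  simp

/-- A coded step keeps only the successor facts over the first objects; the set parameter of
`StepOn` records this truncation. -/
theorem stepOn_of_stepCode {I J : ℕ} {a : (maskInterp S).Act}
    (hJ : J < 2 ^ factBound (D.input b)) (h : StepCode (D.input b) I (actCode a) J) :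
    StepOn (maskInterp S) D.succState I J a {z | z < objBound (D.input b)} := by
  intro F y
  constructor
  · intro hy
    exact eval_succState_iff.1 ((h _ (HasBit.lt_of_lt_two_pow hy hJ)).1 hy)
  · intro hy
    exact (h _ (fact_lt D b hy.1)).2 (eval_succState_iff.2 hy)

theorem exists_stepCode (I k : ℕ) : ∃ J < 2 ^ factBound (D.input b),
    StepCode (D.input b) I k J ∧ WellFormed (D.input b) J := by
  obtain ⟨J, hJ, h⟩ := exists_hasBit_iff (factBound (D.input b)) fun q =>
    ValidTuple (inputFluents (D.input b)) (objBound (D.input b)) q ∧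
    evalCode ((inputActions (D.input b), I), (inputSuccState (D.input b)).getD q.unpair.1 0,
      listOf q.unpair.2, [k]) = true
  exact ⟨J, hJ, fun q hq => (h q).trans (and_iff_right hq), fun q _ hb => ((h q).1 hb).2.1⟩

/-- The coded state represents the situation, via a small matching into the first objects. -/
def Represents (D : BAT S) (b : ℕ) (M : Interp.{u} S) (s : M.Sit) (I : ℕ) : Prop :=
  ∃ p : Finset (M.Obj × ℕ), Match M (maskInterp S) s I (D.input b + 1) p ∧
    (∀ q ∈ p, q.2 < objBound (D.input b)) ∧
    p.card ≤ D.input b + 1 + D.input b * (D.input b * D.input b)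

/-- Dropping inactive objects restores the size bound, so the matching does not grow along a
sequence of actions. -/
theorem Match.represents {M : Interp.{u} S} {s : M.Sit} {I : ℕ} {p : Finset (M.Obj × ℕ)}
    (h : Match M (maskInterp S) s I (D.input b + 1) p)
    (hp : ∀ q ∈ p, q.2 < objBound (D.input b)) (hb : M.Bounded b s) : Represents D b M s I := by
  obtain ⟨q, h1, h2, h3⟩ := h.exists_restriction hb (length_fluentArities_le D b) (le_input D b)
    (fluentArity_le_input D b)
  exact ⟨q, h2, fun r hr => hp r (h1 hr), h3⟩

theorem infinite_of_uniqueNames {M : Interp.{u} S} (h : M.UniqueNames) : Infinite M.Obj :=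
  Infinite.of_injective _ h

/-- Every bounded situation is represented by a coded state. -/
theorem exists_represents {M : Interp.{u} S} (hM : M.UniqueNames) {s : M.Sit}
    (hb : M.Bounded b s) :
    ∃ I < 2 ^ factBound (D.input b), WellFormed (D.input b) I ∧ Represents D b M s I := by
  classical
  obtain ⟨A, hA, hA'⟩ := exists_activeDomain hb (length_fluentArities_le D b) (le_input D b)
    (fluentArity_le_input D b)
  let p₀ : Finset (M.Obj × ℕ) :=
    (Finset.range (D.input b + 1)).image fun c => (M.const c, c)
  have hp₀ : BiUnique p₀ := by
    intro q hq r hr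
    obtain ⟨c, -, rfl⟩ := Finset.mem_image.1 hq
    obtain ⟨d, -, rfl⟩ := Finset.mem_image.1 hr
    exact hM.eq_iff
  have hcard : p₀.card ≤ D.input b + 1 := Finset.card_image_le.trans (by simp)
  obtain ⟨p, h1, h2, h3, h4, h5⟩ := hp₀.exists_extension A
    (Finset.range (objBound (D.input b))) (by
      rw [Finset.card_range, objBound]
      omega)
  have hlt : ∀ q ∈ p, q.2 < objBound (D.input b) := by
    intro q hq
    rcases h4 q hq with hq | hq
    · obtain ⟨c, hc, rfl⟩ := Finset.mem_image.1 hq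
      have := Finset.mem_range.1 hc
      simp only [objBound]
      omega
    · exact Finset.mem_range.1 hq.2
  -- The coded state is the image of the situation's facts under the matching.
  obtain ⟨I, hI, hI'⟩ := exists_hasBit_iff (factBound (D.input b)) fun k =>
    ∃ (F : S.Fluent) (x : Fin (S.fluentArity F) → M.Obj) (y : Fin (S.fluentArity F) → ℕ),
      k = Nat.pair F (encTuple y) ∧ (∀ i, (x i, y i) ∈ p) ∧ M.fluent F x s
  have hfl : ∀ (F : S.Fluent) (y : Fin (S.fluentArity F) → ℕ),
      (maskInterp S).fluent F y I ↔ ∃ x, (∀ i, (x i, y i) ∈ p) ∧ M.fluent F x s := by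
    intro F y
    refine (hI' _).trans ⟨?_, ?_⟩
    · rintro ⟨-, F', x, y', he, h6, h7⟩
      obtain ⟨h8, h9⟩ := Nat.pair_eq_pair.1 he
      obtain rfl : F = F' := Fin.ext h8
      obtain rfl := encTuple_injective h9
      exact ⟨x, h6, h7⟩
    · rintro ⟨x, h6, h7⟩
      exact ⟨fact_lt D b fun i => hlt _ (h6 i), F, x, y, rfl, h6, h7⟩
  refine ⟨I, hI, ?_, Match.represents ⟨h2, ?_, ?_, ?_, ?_⟩ hlt hb⟩
  · intro k _ hbit
    obtain ⟨-, F, x, y, rfl, h6, -⟩ := (hI' k).1 hbit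
    rw [inputFluents_input]
    exact (validTuple_pair_iff F y).2 fun i => hlt _ (h6 i)
  · exact fun c hc => h1 (Finset.mem_image_of_mem _ (Finset.mem_range.2 hc))
  · intro F x y hxy
    rw [hfl]
    refine ⟨fun h => ⟨x, hxy, h⟩, ?_⟩
    rintro ⟨x', h6, h7⟩
    rwa [show x = x' from funext fun i => (h2.eq_iff (hxy i) (h6 i)).2 rfl]
  · exact fun F x hx i => h5 _ (hA' F x hx i)
  · intro F y hy i
    obtain ⟨x, hx, -⟩ := (hfl F y).1 hy
    exact ⟨x i, hx i⟩

theorem Interp.IsModel.stepOn {M : Interp.{u} S} (h : M.IsModel D) (a : M.Act) (s : M.Sit) :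
    StepOn M D.succState s (M.doAct a s) a Set.univ := fun F x =>
  (h.succState F x a s).trans (by simp)

/-- An invariant set of coded states represents all executable situations. -/
theorem isBounded_of_invariant (h₀ : BAT.InitiallyBounded.{u} D b)
    (h : Invariant (D.input b)) : BAT.IsBounded.{u} D b := by
  obtain ⟨R, -, hR⟩ := h
  intro M hM
  have := infinite_of_uniqueNames hM.uniqueNames
  have hA := hM.actionAxioms
  have hN := actionAxioms_maskInterp S
  suffices key : ∀ s, M.Executable s →
      ∃ I < 2 ^ factBound (D.input b), HasBit R I ∧ Represents D b M s I by
    intro s hs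
    obtain ⟨I, hI, hIR, p, hp, -, -⟩ := key s hs
    exact hp.bounded_left (bounded_of_boundedCode hI ((hR I hI).2 hIR).1)
  refine hM.foundational.induction _ (fun _ => ?_) fun a s ih hs => ?_
  -- Initial boundedness enters here: only bounded situations are known to have coded
  -- representatives.
  · have hb := h₀ M hM
    obtain ⟨I, hI, hw, hrep⟩ := exists_represents (D := D) hM.uniqueNames hb
    refine ⟨I, hI, (hR I hI).1 ⟨hw, ?_, ?_⟩, hrep⟩
    · obtain ⟨p, hp, -⟩ := hrep
      exact boundedCode_of_bounded hw (hp.bounded_right hb)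
    · obtain ⟨p, hp, -⟩ := hrep
      exact initialCode_iff.2 fun φ hφ => (hp.holds_iff hA hN φ (initial_code_lt D b hφ)
        (fun i => i.elim0) fun i => i.elim0).1 (hM.initial φ hφ)
  · obtain ⟨hs, hposs⟩ := (hM.foundational.executable_do_iff a s).1 hs
    obtain ⟨I, hI, hIR, p, hp, hlt, hcard⟩ := ih hs
    obtain ⟨A, z, rfl⟩ := hA.closure a
    have hAr := actionArity_le_input D b A
    have hb := le_input D b
    -- The action arguments get partners among the first objects, so the action has a coded
    -- counterpart to which closure of `R` applies.
    obtain ⟨p', h1, h2, h3, h4, y, hy⟩ := hp.biUnique.exists_extension_tuple z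
      (Finset.range (objBound (D.input b))) (by
        rw [Finset.card_range, objBound]
        omega)
    have hlt' : ∀ q ∈ p', q.2 < objBound (D.input b) := fun q hq =>
      (h4 q hq).elim (hlt q) fun h => Finset.mem_range.1 h.2
    have hp' := hp.mono h1 h2
    have hposs' : PossCode (D.input b) I (actCode (S := S) ⟨A, y⟩) := by
      refine possCode_iff.2 ⟨fun i => hlt' _ (hy i), ?_⟩
      exact (hp'.holds_iff hA hN _ (precond_code_lt D b A) hy fun i => i.elim0).1
        ((hM.precond A z s).1 hposs)
    obtain ⟨J, hJ, hJR, hstep⟩ := ((hR I hI).2 hIR).2 _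
      (actCode_lt D b fun i => hlt' _ (hy i)) hposs'
    have hbJ := bounded_of_boundedCode hJ ((hR J hJ).2 hJR).1
    obtain ⟨T, hT⟩ := Infinite.exists_subset_card_eq M.Obj (objBound (D.input b))
    -- With `x` the input, the old matching has at most `x ^ 3 + x + 1` pairs; the action arguments,
    -- the fluent arity and `b` cost at most `x` each, within `x ^ 3 + 4 * x + 10`.
    have hsize : p'.card + D.input b + b ≤ objBound (D.input b) := by
      rw [objBound]
      omega
    have hm := hp'.step hA hN (succState_code_lt D b) ⟨A, z, y, rfl, rfl, hy⟩
      (hM.stepOn _ s) (stepOn_of_stepCode hJ hstep) (fun _ _ => Set.mem_univ _) hlt'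
      (fluentArity_le_input D b) (Finset.range (objBound (D.input b)))
      (fun z hz => Finset.mem_range.1 hz) (by rwa [Finset.card_range]) T
      (fun _ _ => Set.mem_univ _) (by rwa [hT]) hbJ
    exact ⟨J, hJ, hJR, hm.represents hlt' (hm.bounded_left hbJ)⟩

/-- Every coded state that satisfies the initial description represents the initial situation of a
model. -/
theorem exists_model_represents {I : ℕ} (hI : I < 2 ^ factBound (D.input b))
    (hw : WellFormed (D.input b) I) (hb : BoundedCode (D.input b) I)
    (h : InitialCode (D.input b) I) :
    ∃ M : Interp.{u} S, M.IsModel D ∧ Represents D b M M.s0 I := by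
  classical
  -- The coded state, copied to the required universe, becomes the root of the tree of action
  -- sequences.
  let st : State.{u} S := fun F y => (maskInterp S).fluent F (fun i => (y i).down) I
  let p : Finset (ULift.{u} ℕ × ℕ) :=
    (Finset.range (objBound (D.input b))).image fun c => (ULift.up c, c)
  have hmem : ∀ q : ULift.{u} ℕ × ℕ, q ∈ p ↔ q.1.down = q.2 ∧ q.2 < objBound (D.input b) := by
    rintro ⟨⟨a⟩, c⟩
    simp only [p, Finset.mem_image, Finset.mem_range, Prod.mk.injEq, ULift.up.injEq]
    constructor
    · rintro ⟨d, hd, rfl, rfl⟩; exact ⟨rfl, hd⟩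
    · rintro ⟨rfl, hc⟩; exact ⟨a, hc, rfl, rfl⟩
  have hfact : ∀ (F : S.Fluent) (y : Fin (S.fluentArity F) → ℕ), (maskInterp S).fluent F y I →
      ∀ i, y i < objBound (D.input b) := by
    intro F y hy
    have hv := hw _ (HasBit.lt_of_lt_two_pow hy hI) hy
    rw [inputFluents_input] at hv
    exact (validTuple_pair_iff F y).1 hv
  have hm : Match (D.treeModel st) (maskInterp S) (D.treeModel st).s0 I (D.input b + 1) p := by
    refine ⟨?_, ?_, ?_, ?_, ?_⟩
    · intro q hq r hr
      rw [← ((hmem q).1 hq).1, ← ((hmem r).1 hr).1]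
      exact ULift.down_injective.eq_iff.symm
    · intro c hc
      refine (hmem _).2 ⟨rfl, ?_⟩
      simp only [objBound, id]
      omega
    · intro F x y hxy
      rw [show y = fun i => (x i).down from funext fun i => ((hmem _).1 (hxy i)).1.symm]
      exact Iff.rfl
    · exact fun F x hx i => ⟨(x i).down, (hmem _).2 ⟨rfl, hfact F _ hx i⟩⟩
    · exact fun F y hy i => ⟨ULift.up (y i), (hmem _).2 ⟨rfl, hfact F y hy i⟩⟩
  have : Infinite (D.treeModel st).Obj := inferInstanceAs (Infinite (ULift.{u} ℕ))
  refine ⟨D.treeModel st, D.isModel_treeModel st fun φ hφ => ?_,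
    hm.represents (fun q hq => ((hmem q).1 hq).2)
      (hm.bounded_left (bounded_of_boundedCode hI hb))⟩
  exact (hm.holds_iff (D.actionAxioms_treeModel st) (actionAxioms_maskInterp S) φ
    (initial_code_lt D b hφ) (fun i => i.elim0) fun i => i.elim0).2 (initialCode_iff.1 h φ hφ)

/-- The coded states that represent executable situations of models form an invariant set. -/
theorem invariant_of_isBounded (h : BAT.IsBounded.{u} D b) : Invariant (D.input b) := by
  obtain ⟨R, hR, hR'⟩ := exists_hasBit_iff (2 ^ factBound (D.input b)) fun I =>
    WellFormed (D.input b) I ∧ ∃ M : Interp.{u} S, M.IsModel D ∧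
      ∃ s, M.Executable s ∧ Represents D b M s I
  refine ⟨R, hR, fun I hI => ⟨?_, fun hIR => ?_⟩⟩
  · rintro ⟨hw, hb, h0⟩
    obtain ⟨M, hM, hrep⟩ := exists_model_represents.{u} hI hw hb h0
    exact (hR' I).2 ⟨hI, hw, M, hM, M.s0, hM.foundational.executable_s0, hrep⟩
  obtain ⟨-, hw, M, hM, s, hs, p, hp, hlt, hcard⟩ := (hR' I).1 hIR
  have := infinite_of_uniqueNames hM.uniqueNames
  have hA := hM.actionAxioms
  have hN := actionAxioms_maskInterp S
  refine ⟨boundedCode_of_bounded hw (hp.bounded_right (h M hM s hs)), fun k _ hposs => ?_⟩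
  obtain ⟨A, y, rfl, hyN⟩ : ∃ (A : S.ActionType) (y : Fin (S.actionArity A) → ℕ),
      k = actCode (S := S) ⟨A, y⟩ ∧ ∀ i, y i < objBound (D.input b) := by
    have hv := hposs.1
    rw [inputActions_input] at hv
    exact validTuple_iff.1 hv
  have hposs' := (possCode_iff.1 hposs).2
  have hAr := actionArity_le_input D b A
  have hb := le_input D b
  obtain ⟨T, hT⟩ := Infinite.exists_subset_card_eq M.Obj (objBound (D.input b))
  have hcard' := card_converse (p := p)
  -- The coded action must now be realised in the model, so the converse matching is extended, with
  -- partners in `M`.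
  obtain ⟨p', h1, h2, h3, h4, z, hz⟩ := hp.biUnique.converse.exists_extension_tuple y T (by
    rw [hT, objBound]
    omega)
  have hlt' : ∀ q ∈ p', q.1 < objBound (D.input b) := by
    intro q hq
    rcases h4 q hq with hq | ⟨⟨i, hi⟩, -⟩
    · exact hlt _ (mem_converse.1 hq)
    · exact hi ▸ hyN i
  have hp' := hp.converse.mono h1 h2
  have hexec : M.Executable (M.doAct (M.action A z) s) := by
    refine (hM.foundational.executable_do_iff _ _).2 ⟨hs, (hM.precond A z s).2 ?_⟩
    exact (hp'.holds_iff hN hA _ (precond_code_lt D b A) hz fun i => i.elim0).1 hposs'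
  -- Boundedness of the theory bounds the model's successor; `Match.step` then transfers this to the
  -- coded one.
  have hbM := h M hM _ hexec
  obtain ⟨J, hJ, hstep, hwJ⟩ := exists_stepCode (D := D) (b := b) I (actCode (S := S) ⟨A, y⟩)
  have hsize : p'.card + D.input b + b ≤ objBound (D.input b) := by
    rw [objBound]
    omega
  have hm := hp'.step hN hA (succState_code_lt D b) ⟨A, y, z, rfl, rfl, hz⟩
    (stepOn_of_stepCode hJ hstep) (hM.stepOn _ s) hlt' (fun _ _ => Set.mem_univ _)
    (fluentArity_le_input D b) T (fun _ _ => Set.mem_univ _) (by rwa [hT])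
    (Finset.range (objBound (D.input b))) (fun z hz => Finset.mem_range.1 hz)
    (by rwa [Finset.card_range]) hbM
  refine ⟨J, hJ, (hR' J).2 ⟨hJ, hwJ, M, hM, _, hexec, ?_⟩, hstep⟩
  exact hm.converse.represents (fun q hq => hlt' _ (mem_converse.1 hq)) hbM

end Correctness

end SitCalc

theorem mainTheorem6 :
    ∃ f : ℕ → Bool, Computable f ∧
      ∀ (S : SitCalc.Signature) (D : SitCalc.BAT S) (b : ℕ),
        SitCalc.BAT.InitiallyBounded.{u} D b →
          (f (Nat.pair D.code b) = true ↔ SitCalc.BAT.IsBounded.{u} D b) := by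
  -- The test for `Invariant` is the required algorithm; it is total, even on numbers that code no
  -- theory.
  obtain ⟨_, hf⟩ := SitCalc.primrecPred_invariant
  refine ⟨fun x => decide (SitCalc.Invariant x), hf.to_comp, fun S D b h₀ => ?_⟩
  rw [decide_eq_true_iff]
  exact ⟨SitCalc.isBounded_of_invariant h₀, SitCalc.invariant_of_isBounded⟩
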